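/- All rings are commutative with $1$. Fix $m\ge 0$. A differential ring is a ring together with $m$ commuting derivations; a differential field is a differential ring that is a field, here of characteristic $0$. If $(K,\Delta)$, $\Delta=(\delta_1,\dots,\delta_m)$, is a differential field, a differential $K$-algebra is a $K$-algebra $S$ equipped with $m$ commuting derivations such that the structure map $K\to S$ commutes with the respective derivations. It is differentially finitely generated if it has a finite subset that is contained in no proper $K$-subalgebra closed under the derivations. A field $K$ is large if every irreducible affine variety over $K$ with a smooth $K$-point has a Zariski-dense set of $K$-points. A field $K$ is existentially closed (e.c.) in a field extension $L$ if every finite system of polynomial equations $P=0$ and inequations $Q\neq 0$ with coefficients in $K$ that has a solution in $L$ also has a solution in $K$. For $\mathbf t=(t_1,\dots,t_m)$, each $\delta_i$ is extended to $K[[\mathbf t]]$ by differentiating coefficients, and $\Delta+\frac{\mathrm d}{\mathrm d\mathbf t}$ denotes the family of commuting derivations $\delta_i+\frac{\mathrm d}{\mathrm dt_i}$ $(1\le i\le m)$ of $K[[\mathbf t]]$. **Corollary.** Let $(K,\Delta)$ be a differential field of characteristic $0$ in $m$ commuting derivations that is large as a field, and let $S$ be a differentially finitely generated differential $K$-algebra.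 Suppose there is a (not necessarily differential) $K$-algebra homomorphism $S\to L$ for some field extension $L/K$ in which $K$ is e.c. as a field (no derivations on $L$ are given). Then there is a differential $K$-algebra homomorphism $S\to K[[\mathbf t]]$, that is, a $K$-algebra homomorphism commuting with the derivations, where $K[[\mathbf t]]$ carries the derivations $\Delta+\frac{\mathrm d}{\mathrm d\mathbf t}$. -/

import Mathlib

/-- Derivations `R → R` of a commutative ring `R`: additive maps satisfying the Leibniz rule. -/
abbrev SelfDerivation (R : Type*) [CommRing R] := Derivation ℤ R R

/-- Build a derivation `R → R` from an additive map satisfying the Leibniz rule. -/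
def SelfDerivation.ofAddMonoidHom {R : Type*} [CommRing R] (d : R →+ R)
    (h : ∀ a b, d (a * b) = d a * b + a * d b) : SelfDerivation R :=
  Derivation.mk' d.toIntLinearMap fun a b => by
    simp only [AddMonoidHom.coe_toIntLinearMap, smul_eq_mul, h]
    ring

/-- A family `δ₁, …, δ_m` of pairwise commuting derivations on a commutative ring `R`.
The pair `(R, Δ)` is a differential ring in `m` commuting derivations. -/
structure CommutingDerivations (m : ℕ) (R : Type*) [CommRing R] where
  /-- The derivations `δ₁, …, δ_m`. -/
  der : Fin m → SelfDerivation R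
  /-- The derivations commute with each other. -/
  comm : ∀ (i j : Fin m) (a : R), der i (der j a) = der j (der i a)

/-- A ring homomorphism is differential if it commutes with the distinguished derivations. -/
def IsDifferentialHom {m : ℕ} {R S : Type*} [CommRing R] [CommRing S]
    (Δ : CommutingDerivations m R) (Ω : CommutingDerivations m S) (f : R →+* S) : Prop :=
  ∀ (i : Fin m) (a : R), f (Δ.der i a) = Ω.der i (f a)

/-- An `R`-algebra `S` with commuting derivations is a differential `R`-algebra if the structure
map `R → S` is a differential ring homomorphism. -/
def IsDifferentialAlgebra {m : ℕ} {R S : Type*} [CommRing R] [CommRing S] [Algebra R S]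
    (Δ : CommutingDerivations m R) (Ω : CommutingDerivations m S) : Prop :=
  IsDifferentialHom Δ Ω (algebraMap R S)

/-- `S` is differentially finitely generated over `R`: some finite subset of `S` is contained in
no proper `R`-subalgebra that is closed under the derivations. -/
def IsDifferentiallyFG {m : ℕ} (R : Type*) {S : Type*} [CommRing R] [CommRing S] [Algebra R S]
    (Ω : CommutingDerivations m S) : Prop :=
  ∃ s : Finset S, ∀ T : Subalgebra R S, (s : Set S) ⊆ T →
    (∀ (i : Fin m), ∀ x ∈ T, Ω.der i x ∈ T) → T = ⊤

/-- `K` is existentially closed in `L` as a field (no derivations involved): every finite system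
of polynomial equations `P = 0` and inequations `Q ≠ 0` over `K` that has a solution in `L` has a
solution in `K`. -/
def IsExistentiallyClosedIn (K L : Type*) [Field K] [Field L] [Algebra K L] : Prop :=
  ∀ (n : ℕ) (F G : Finset (MvPolynomial (Fin n) K)),
    (∃ b : Fin n → L, (∀ P ∈ F, MvPolynomial.aeval b P = 0) ∧
      ∀ Q ∈ G, MvPolynomial.aeval b Q ≠ 0) →
    ∃ a : Fin n → K, (∀ P ∈ F, MvPolynomial.eval a P = 0) ∧
      ∀ Q ∈ G, MvPolynomial.eval a Q ≠ 0

/-- A field `K` is large if every irreducible affine variety over `K` with a smooth `K`-point has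
a Zariski-dense set of `K`-points. Irreducible affine varieties are given by their coordinate
rings `A` (finitely generated `K`-algebras that are domains), `K`-points are `K`-algebra
homomorphisms `A → K`, and density says that no nonzero `a ∈ A` vanishes at all of them. -/
def IsLargeField.{u} (K : Type u) [Field K] : Prop :=
  ∀ (A : Type u) [CommRing A] [IsDomain A] [Algebra K A] [Algebra.FiniteType K A],
    (∃ p : A →ₐ[K] K,
      (⟨RingHom.ker p, RingHom.ker_isPrime p⟩ : PrimeSpectrum A) ∈ Algebra.smoothLocus K A) →
    ∀ a : A, a ≠ 0 → ∃ q : A →ₐ[K] K, q a ≠ 0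

/-- The extension of a derivation `d` of `R` to `R[[t]]` that differentiates coefficients:
`∑ a_α t^α ↦ ∑ d(a_α) t^α`. -/
noncomputable def coeffDerivation {σ R : Type*} [CommRing R] (d : SelfDerivation R) :
    SelfDerivation (MvPowerSeries σ R) :=
  SelfDerivation.ofAddMonoidHom
    { toFun := fun f α => d (MvPowerSeries.coeff α f)
      map_zero' := by
        funext α
        exact map_zero d
      map_add' := fun f g => by
        funext α
        exact map_add d _ _ }
    (fun f g => by
      classical
      ext α
      change d (MvPowerSeries.coeff α (f * g)) = _
      rw [map_add, MvPowerSeries.coeff_mul, MvPowerSeries.coeff_mul, MvPowerSeries.coeff_mul,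
        map_sum, ← Finset.sum_add_distrib]
      refine Finset.sum_congr rfl fun x _ => ?_
      rw [Derivation.leibniz, smul_eq_mul, smul_eq_mul, add_comm, mul_comm _ (d _)]
      rfl)

theorem coeff_coeffDerivation {σ R : Type*} [CommRing R] (d : SelfDerivation R) (α : σ →₀ ℕ)
    (f : MvPowerSeries σ R) :
    MvPowerSeries.coeff α (coeffDerivation d f) = d (MvPowerSeries.coeff α f) :=
  rfl

/-- The derivation `δᵢ + d/dtᵢ` on `R[[t₁, …, t_m]]`. -/
noncomputable def seriesDerivation {m : ℕ} {R : Type*} [CommRing R]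
    (Δ : CommutingDerivations m R) (i : Fin m) : SelfDerivation (MvPowerSeries (Fin m) R) :=
  SelfDerivation.ofAddMonoidHom
    { toFun := fun f => coeffDerivation (Δ.der i) f + MvPowerSeries.pderiv R i f
      map_zero' := by simp
      map_add' := fun f g => by simp only [map_add]; ring }
    (fun f g => by
      simp only [AddMonoidHom.coe_mk, ZeroHom.coe_mk, Derivation.leibniz, smul_eq_mul]
      ring)

theorem coeff_seriesDerivation {m : ℕ} {R : Type*} [CommRing R] (Δ : CommutingDerivations m R)
    (i : Fin m) (α : Fin m →₀ ℕ) (f : MvPowerSeries (Fin m) R) :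
    MvPowerSeries.coeff α (seriesDerivation Δ i f) =
      Δ.der i (MvPowerSeries.coeff α f) +
        MvPowerSeries.coeff (α + Finsupp.single i 1) f * (α i + 1) := by
  rw [← MvPowerSeries.coeff_pderiv, ← coeff_coeffDerivation, ← map_add]
  rfl

/-- The differential ring `(R[[t₁, …, t_m]], Δ + d/dt)`. -/
noncomputable def CommutingDerivations.powerSeries {m : ℕ} {R : Type*} [CommRing R]
    (Δ : CommutingDerivations m R) : CommutingDerivations m (MvPowerSeries (Fin m) R) where
  der := seriesDerivation Δ
  comm i j f := by
    have h : ∀ (k : Fin m) (c : R) (n : ℕ), Δ.der k (c * (n + 1)) = Δ.der k c * (n + 1) := by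
      intro k c n
      have : ((n : R) + 1) = ((n + 1 : ℕ) : R) := by push_cast; rfl
      rw [this, Derivation.leibniz, Derivation.map_natCast, smul_zero, zero_add, smul_eq_mul,
        mul_comm]
    ext α
    simp only [coeff_seriesDerivation, map_add, h, Δ.comm i j]
    rw [add_right_comm α]
    by_cases hij : i = j
    · subst hij; rfl
    · simp only [Finsupp.add_apply, Finsupp.single_apply, hij, Ne.symm hij, if_false, add_zero]
      ring

/-! The twisted Taylor map turns any `K`-algebra homomorphism from `S` to a characteristic-zero
differential field extension `A` of `K` into a differential homomorphism `S → A[[t]]`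
(`exists_differentialHom_powerSeries`). Hence it suffices to find a plain `K`-point `S → K`
(`IsLargeField.nonempty_algHom`).

Existential closedness moves the given point from `L` into an ultrapower of `K`, which, unlike `L`,
carries derivations extending those of `K`. A Taylor expansion there gives a differential
homomorphism from `S` to power series over the ultrapower, a differential domain of characteristic
zero. In such a domain Ritt's argument applies: among the derivatives of finitely many generators,
each is transcendental over the lower ones, or lies below a finite bound, or becomes a polynomial in
lower ones after multiplication by a separant. By Dickson's lemma finitely many separants suffice,
so a `K`-point of some finitely generated subalgebra `B` extends to the whole differential
subalgebra once it avoids a single nonzero `η` (`exists_fg_subalgebra_forall_exists_der_closed`).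

It remains to find a `K`-point of `B` with `η ≠ 0`. Restricting to a generic line sends `B` to
one-variable power series over the ultrapower without killing `η`. The image is birational to a
hypersurface. Łoś's principle, applied to finitely many coefficients, gives a power series over `K`
that solves its equation to more than twice the order of the partial derivative. A Newton
substitution converts this into a plane curve smooth at the origin, where largeness supplies points
(`IsLargeField.exists_algHom_of_algHom_powerSeries`). -/

/-! ### Smooth plane curves over large fields. -/

open Polynomial in
/-- Inverting the derivative of `p` at the root makes `R[X]/(p)` formally smooth over `R`. -/
theorem formallySmooth_away_derivative_root {R : Type*} [CommRing R] (p : R[X]) :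
    Algebra.FormallySmooth R
      (Localization.Away (AdjoinRoot.mk p (derivative p))) := by
  set A := Localization.Away (AdjoinRoot.mk p (derivative p))
  refine Algebra.FormallySmooth.of_comp_surjective fun B _ _ I hI f => ?_
  let g : AdjoinRoot p →ₐ[R] B ⧸ I := f.comp (IsScalarTower.toAlgHom R (AdjoinRoot p) A)
  have hg : ∀ q : R[X], g (AdjoinRoot.mk p q) = aeval (g (AdjoinRoot.root p)) q := fun q => by
    rw [Polynomial.aeval_algHom_apply, AdjoinRoot.aeval_eq]
  obtain ⟨b, hb⟩ := Ideal.Quotient.mkₐ_surjective R I (g (AdjoinRoot.root p))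
  have hmk : ∀ (q : R[X]) (c : B), Ideal.Quotient.mkₐ R I (aeval c q) =
      aeval (Ideal.Quotient.mkₐ R I c) q := fun q c => (Polynomial.aeval_algHom_apply _ _ _).symm
  have hnil : ∀ c : B, Ideal.Quotient.mkₐ R I c = 0 → IsNilpotent c := fun c hc =>
    ⟨2, by
      have : c ∈ I := Ideal.Quotient.eq_zero_iff_mem.mp hc
      have h2 := Ideal.pow_mem_pow this 2
      rwa [hI, Ideal.mem_bot] at h2⟩
  have hunit : ∀ c : B, IsUnit (Ideal.Quotient.mkₐ R I c) → IsUnit c := fun c hc => by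
    obtain ⟨d, hd⟩ := hc.exists_right_inv
    obtain ⟨e, rfl⟩ := Ideal.Quotient.mkₐ_surjective R I d
    have h1 : IsNilpotent (1 - c * e) := hnil _ (by rw [map_sub, map_mul, hd, map_one, sub_self])
    have h2 : IsUnit (c * e) := by simpa using h1.isUnit_one_sub
    exact isUnit_of_mul_isUnit_left h2
  have hz : aeval (g (AdjoinRoot.root p)) p = 0 := by rw [← hg, AdjoinRoot.mk_self, map_zero]
  have hz' : IsUnit (aeval (g (AdjoinRoot.root p)) (derivative p)) := by
    rw [← hg]
    exact (IsLocalization.Away.algebraMap_isUnit (S := A)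
      (AdjoinRoot.mk p (derivative p))).map f
  obtain ⟨r, ⟨hr1, hr2⟩, -⟩ := existsUnique_nilpotent_sub_and_aeval_eq_zero (P := p) (x := b)
    (hnil _ (by rw [hmk, hb, hz])) (hunit _ (by rw [hmk, hb]; exact hz'))
  -- Newton's lemma only says that `r - b` is nilpotent. That `r` lies exactly over the given root
  -- follows from uniqueness of the nearby root in `B ⧸ I`.
  have hr : Ideal.Quotient.mkₐ R I r = g (AdjoinRoot.root p) := by
    refine (existsUnique_nilpotent_sub_and_aeval_eq_zero (P := p)
      (x := g (AdjoinRoot.root p)) (by rw [hz]; exact IsNilpotent.zero) hz').unique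
      ⟨?_, ?_⟩ ⟨by rw [sub_self]; exact IsNilpotent.zero, hz⟩
    · rw [← hb, ← map_sub]; exact hr1.map _
    · rw [← hmk, hr2, map_zero]
  let l : AdjoinRoot p →ₐ[R] B := AdjoinRoot.liftAlgHom p (Algebra.ofId R B) r hr2
  have hl : (Ideal.Quotient.mkₐ R I).comp l = g := by
    apply AdjoinRoot.algHom_ext
    rw [AlgHom.comp_apply, ← hr]
    exact congrArg _ (AdjoinRoot.liftAlgHom_root _ _ _ _)
  have hlu : ∀ y : Submonoid.powers (AdjoinRoot.mk p (derivative p)), IsUnit (l y) := by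
    rintro ⟨_, n, rfl⟩
    apply hunit
    have : Ideal.Quotient.mkₐ R I (l (AdjoinRoot.mk p (derivative p) ^ n)) =
      g (AdjoinRoot.mk p (derivative p)) ^ n := by
      rw [← hl, map_pow, map_pow]; rfl
    change IsUnit (Ideal.Quotient.mkₐ R I (l (AdjoinRoot.mk p (derivative p) ^ n)))
    rw [this, hg]
    exact hz'.pow n
  refine ⟨IsLocalization.liftAlgHom (S := A) hlu, ?_⟩
  apply IsLocalization.algHom_ext (Submonoid.powers (AdjoinRoot.mk p (derivative p)))
  have : (IsLocalization.liftAlgHom (S := A) hlu).comp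
      (IsScalarTower.toAlgHom R (AdjoinRoot p) A) = l := by
    ext; simp
  change (Ideal.Quotient.mkₐ R I).comp ((IsLocalization.liftAlgHom (S := A) hlu).comp
      (IsScalarTower.toAlgHom R (AdjoinRoot p) A)) = g
  rw [this, hl]

open Polynomial in
/-- A plane curve over a large field which is smooth at the origin, in the direction of the first
coordinate, has rational points outside any finite union of vertical lines. -/
theorem IsLargeField.exists_evalEval_eq_zero {K : Type*} [Field K] (hK : IsLargeField K)
    (G : K[X][X]) (h0 : G.evalEval 0 0 = 0) (h1 : (derivative G).evalEval 0 0 ≠ 0)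
    (e : K[X]) (he : e ≠ 0) : ∃ a b : K, G.evalEval a b = 0 ∧ e.eval a ≠ 0 := by
  have hG : G ≠ 0 := by rintro rfl; simp at h1
  -- Largeness needs an irreducible curve. A prime factor through the origin inherits smoothness
  -- there by the product rule.
  obtain ⟨p, hp, hpG, hp0⟩ : ∃ p : K[X][X], Prime p ∧ p ∣ G ∧ p.evalEval 0 0 = 0 := by
    obtain ⟨f, hf, u, hu⟩ := UniqueFactorizationMonoid.exists_prime_factors G hG
    have : (f.map (evalEval 0 0)).prod = 0 := by
      rw [← evalEval_multiset_prod]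
      rw [← hu, evalEval_mul] at h0
      exact (mul_eq_zero.mp h0).resolve_right
        ((u.isUnit.map (evalEvalRingHom (0 : K) 0)).ne_zero)
    obtain ⟨p, hp, hp0⟩ := Multiset.mem_map.mp (Multiset.prod_eq_zero_iff.mp this)
    exact ⟨p, hf p hp, (Multiset.dvd_prod hp).trans ⟨u, hu.symm⟩, hp0⟩
  have hp1 : (derivative p).evalEval 0 0 ≠ 0 := by
    obtain ⟨q, rfl⟩ := hpG
    rw [derivative_mul, evalEval_add, evalEval_mul, evalEval_mul, hp0, zero_mul, add_zero] at h1
    exact left_ne_zero_of_mul h1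
  -- The second coordinate really occurs in `p`, so `e`, a polynomial in the first coordinate alone,
  -- does not vanish identically on the curve.
  have hndvd : ∀ q : K[X], q ≠ 0 → ¬ p ∣ C q := fun q hq hd => by
    have := natDegree_le_of_dvd hd (by simpa using hq)
    rw [natDegree_C, Nat.le_zero] at this
    rw [eq_C_of_natDegree_eq_zero this] at hp1
    simp at hp1
  have hpd : ¬ p ∣ derivative p := fun hd => by
    have := evalEval_dvd (0 : K) 0 hd
    rw [hp0, zero_dvd_iff] at this
    exact hp1 this
  have := AdjoinRoot.isDomain_of_prime hp
  set s : AdjoinRoot p := AdjoinRoot.mk p (derivative p) with hs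
  have hs0 : s ≠ 0 := by rwa [hs, Ne, AdjoinRoot.mk_eq_zero]
  have hM : Submonoid.powers s ≤ nonZeroDivisors (AdjoinRoot p) :=
    powers_le_nonZeroDivisors_of_noZeroDivisors hs0
  let A := Localization.Away s
  have : IsDomain A := IsLocalization.isDomain_localization hM
  have : Algebra.FormallySmooth K[X] A := formallySmooth_away_derivative_root p
  have : Algebra.FormallySmooth K A := Algebra.FormallySmooth.comp K K[X] A
  have : Algebra.FiniteType K[X] (AdjoinRoot p) := inferInstance
  have : Algebra.FiniteType K (AdjoinRoot p) :=
    Algebra.FiniteType.trans (S := K[X]) inferInstance inferInstance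
  have : Algebra.FiniteType K A :=
    Algebra.FiniteType.trans (S := AdjoinRoot p) inferInstance inferInstance
  have : Algebra.FinitePresentation K A :=
    Algebra.FinitePresentation.of_finiteType.mp inferInstance
  have : Algebra.Smooth K A := ⟨inferInstance, inferInstance⟩
  let l : AdjoinRoot p →ₐ[K] K := AdjoinRoot.liftAlgHom p (aeval (0 : K)) 0 (by
    have h := eval₂_evalRingHom (0 : K)
    exact (congrFun (congrFun h 0) p).trans hp0)
  have hlmk : ∀ q, l (AdjoinRoot.mk p q) = q.evalEval 0 0 := fun q => by
    rw [← eval₂_evalRingHom]; rfl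
  have hlu : ∀ y : Submonoid.powers s, IsUnit (l y) := by
    rintro ⟨_, n, rfl⟩
    change IsUnit (l (s ^ n))
    rw [map_pow, hs, hlmk]
    exact (isUnit_iff_ne_zero.mpr hp1).pow n
  have hinj : Function.Injective (algebraMap (AdjoinRoot p) A) := IsLocalization.injective A hM
  obtain ⟨q, hq⟩ := hK A ⟨IsLocalization.liftAlgHom (S := A) hlu, by
    rw [Algebra.smoothLocus_eq_univ]; trivial⟩
    (algebraMap (AdjoinRoot p) A (AdjoinRoot.mk p (C e))) (by
      rw [Ne, map_eq_zero_iff _ hinj, AdjoinRoot.mk_eq_zero]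
      exact hndvd e he)
  let g : K[X][X] →+* K :=
    (q : A →+* K).comp ((algebraMap (AdjoinRoot p) A).comp (AdjoinRoot.mk p))
  have hg : g = evalEvalRingHom (g (C X)) (g X) := by
    refine Polynomial.ringHom_ext' (Polynomial.ringHom_ext' (RingHom.ext fun c => ?_) ?_) ?_
    · have : g (C (C c)) = c := q.commutes c
      simpa using this
    · simp
    · simp
  refine ⟨g (C X), g X, ?_, ?_⟩
  · rw [← coe_evalEvalRingHom, ← hg]
    obtain ⟨r, rfl⟩ := hpG
    have : g p = 0 := by simp [g]
    rw [map_mul, this, zero_mul]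
  · rw [← evalEval_C (g (C X)) (g X), ← coe_evalEvalRingHom, ← hg]
    exact hq

/-! ### Iterates of commuting operators. -/

/-- Products of powers of a commuting family, indexed by multi-indices. -/
noncomputable def multiPow {m : ℕ} {M : Type*} [Monoid M] (D : Fin m → M)
    (hD : ∀ i j, Commute (D i) (D j)) : (Fin m → Multiplicative ℕ) →* M :=
  MonoidHom.noncommPiCoprod (fun i => powersHom M (D i)) fun i j _ x y => by
    simpa using (hD i j).pow_pow _ _

/-- `multiPow` for finitely supported multi-indices. -/
noncomputable def multiIter {m : ℕ} {M : Type*} [Monoid M] (D : Fin m → M)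
    (hD : ∀ i j, Commute (D i) (D j)) (α : Fin m →₀ ℕ) : M :=
  multiPow D hD fun i => Multiplicative.ofAdd (α i)

section
variable {m : ℕ} {M : Type*} [Monoid M] (D : Fin m → M) (hD : ∀ i j, Commute (D i) (D j))

theorem multiIter_zero : multiIter D hD 0 = 1 := map_one (multiPow D hD)

theorem multiIter_add (α β : Fin m →₀ ℕ) :
    multiIter D hD (α + β) = multiIter D hD α * multiIter D hD β := by
  rw [multiIter, multiIter, multiIter, ← map_mul]; rfl

theorem multiIter_single (i : Fin m) : multiIter D hD (Finsupp.single i 1) = D i := by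
  have : (fun j => Multiplicative.ofAdd ((Finsupp.single i 1 : Fin m →₀ ℕ) j)) =
      Pi.mulSingle i (Multiplicative.ofAdd 1) := by
    funext j
    by_cases h : j = i
    · subst h; simp
    · simp [h]
  rw [multiIter, this]
  exact (MonoidHom.noncommPiCoprod_mulSingle (fun i => powersHom M (D i)) i _).trans (by simp)

theorem multiIter_single_add (i : Fin m) (α : Fin m →₀ ℕ) :
    multiIter D hD (α + Finsupp.single i 1) = D i * multiIter D hD α := by
  rw [add_comm, multiIter_add, multiIter_single]
end

/-! ### The twisted Taylor homomorphism. -/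

section Taylor
variable {m : ℕ} {S A : Type*} [CommRing S] [Field A]
  (Ω : CommutingDerivations m S) (Δ : CommutingDerivations m A)

/-- The operator `ψ ↦ ψ ∘ ∂ᵢ - δᵢ ∘ ψ` on additive maps between differential rings. -/
noncomputable def commutatorOp (i : Fin m) : Module.End ℤ (S →+ A) where
  toFun ψ := ψ.comp (Ω.der i).toLinearMap.toAddMonoidHom -
    (Δ.der i).toLinearMap.toAddMonoidHom.comp ψ
  map_add' ψ χ := by ext; simp; abel
  map_smul' n ψ := by ext; simp [mul_sub]

theorem commutatorOp_apply (i : Fin m) (ψ : S →+ A) (a : S) :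
    commutatorOp Ω Δ i ψ a = ψ (Ω.der i a) - Δ.der i (ψ a) := rfl

theorem commute_commutatorOp (i j : Fin m) :
    Commute (commutatorOp Ω Δ i) (commutatorOp Ω Δ j) := by
  refine LinearMap.ext fun ψ => AddMonoidHom.ext fun a => ?_
  simp only [Module.End.mul_apply, commutatorOp_apply, map_sub, Ω.comm i j, Δ.comm i j]
  abel

/-- The twisted Taylor series of an additive map between differential rings. -/
noncomputable def twistedTaylor (ψ : S →+ A) (a : S) : MvPowerSeries (Fin m) A := fun α =>
  (∏ i, ((α i).factorial : A))⁻¹ *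
    multiIter (commutatorOp Ω Δ) (commute_commutatorOp Ω Δ) α ψ a

theorem coeff_twistedTaylor (ψ : S →+ A) (a : S) (α : Fin m →₀ ℕ) :
    MvPowerSeries.coeff α (twistedTaylor Ω Δ ψ a) = (∏ i, ((α i).factorial : A))⁻¹ *
      multiIter (commutatorOp Ω Δ) (commute_commutatorOp Ω Δ) α ψ a := rfl

theorem coeff_zero_twistedTaylor (ψ : S →+ A) (a : S) :
    MvPowerSeries.coeff 0 (twistedTaylor Ω Δ ψ a) = ψ a := by
  simp [coeff_twistedTaylor, multiIter_zero]

/-- A derivation of a field kills inverses of naturals. -/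
theorem SelfDerivation.map_natCast_inv_mul (d : SelfDerivation A) (n : ℕ) (a : A) :
    d ((n : A)⁻¹ * a) = (n : A)⁻¹ * d a := by
  have : d ((n : A)⁻¹) = 0 := by simp [Derivation.leibniz_inv]
  rw [Derivation.leibniz, this, smul_zero, add_zero, smul_eq_mul]

/-- With `Dᵢψ = ψ∂ᵢ - δᵢψ`, the coefficient at `α` is `D^αψ / α!`. Writing `(D^αψ)∂ᵢ = DᵢD^αψ +
δᵢD^αψ`, the first summand produces `d/dtᵢ` and the second the coefficientwise `δᵢ`, because `δᵢ`
kills `1/α!`. -/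
theorem twistedTaylor_der [CharZero A] (ψ : S →+ A) (i : Fin m) (a : S) :
    twistedTaylor Ω Δ ψ (Ω.der i a) = seriesDerivation Δ i (twistedTaylor Ω Δ ψ a) := by
  ext α
  have hprod : (∏ j, (((α + Finsupp.single i 1 : Fin m →₀ ℕ) j).factorial : A)) =
      (α i + 1) * ∏ j, ((α j).factorial : A) := by
    rw [← Finset.mul_prod_erase _ _ (Finset.mem_univ i),
      ← Finset.mul_prod_erase (a := i) _ (fun j => ((α j).factorial : A)) (Finset.mem_univ i),
      ← mul_assoc]
    congr 1
    · simp [Nat.factorial_succ]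
    · refine Finset.prod_congr rfl fun j hj => ?_
      rw [Finsupp.add_apply, Finsupp.single_eq_of_ne (Finset.ne_of_mem_erase hj), add_zero]
  have hne : ((α i : A) + 1) ≠ 0 := by exact_mod_cast Nat.succ_ne_zero (α i)
  rw [coeff_seriesDerivation, coeff_twistedTaylor, coeff_twistedTaylor, coeff_twistedTaylor,
    hprod, multiIter_single_add, Module.End.mul_apply, commutatorOp_apply, ← Nat.cast_prod,
    SelfDerivation.map_natCast_inv_mul, mul_inv]
  field_simp
  ring

/-- An additive group of power series without constant terms which is stable under the
derivations `δᵢ + d/dtᵢ` is zero. -/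
theorem eq_zero_of_forall_seriesDerivation_mem [CharZero A]
    (V : AddSubgroup (MvPowerSeries (Fin m) A)) (h0 : ∀ f ∈ V, MvPowerSeries.coeff 0 f = 0)
    (h : ∀ i, ∀ f ∈ V, seriesDerivation Δ i f ∈ V) {f : MvPowerSeries (Fin m) A} (hf : f ∈ V) :
    f = 0 := by
  have key : ∀ n, ∀ α : Fin m →₀ ℕ, α.degree = n → ∀ g ∈ V, MvPowerSeries.coeff α g = 0 := by
    intro n
    induction n with
    | zero =>
      intro α hα
      rw [Finsupp.degree_eq_zero_iff] at hα
      subst hα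
      exact h0
    | succ n ih =>
      intro α hα g hg
      obtain ⟨i, hi⟩ : ∃ i, α i ≠ 0 := by
        by_contra! hc
        rw [show α = 0 from Finsupp.ext hc] at hα
        simp at hα
      obtain ⟨β, rfl⟩ : ∃ β, α = β + Finsupp.single i 1 :=
        ⟨α - Finsupp.single i 1, (tsub_add_cancel_of_le (by
          rw [Finsupp.single_le_iff]; omega)).symm⟩
      have hβ : β.degree = n := by simpa using hα
      have h1 := ih β hβ _ (h i g hg)
      rw [coeff_seriesDerivation, ih β hβ g hg, map_zero, zero_add] at h1
      -- The coefficient of `g` at `β + eᵢ`, times `βᵢ + 1`, is the coefficient at `β` of another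
      -- member of `V`; characteristic zero allows cancelling the factor.
      exact (mul_eq_zero.mp h1).resolve_right (by exact_mod_cast Nat.succ_ne_zero (β i))
  ext α
  exact key _ α rfl f hf

/-- A family of power series without constant terms whose additive span is stable under the
derivations `δᵢ + d/dtᵢ` is zero. -/
theorem eq_zero_of_seriesDerivation_mem_closure {ι : Type*} [CharZero A]
    (f : ι → MvPowerSeries (Fin m) A) (h0 : ∀ k, MvPowerSeries.coeff 0 (f k) = 0)
    (h : ∀ i k, seriesDerivation Δ i (f k) ∈ AddSubgroup.closure (Set.range f)) (k : ι) :
    f k = 0 := by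
  refine eq_zero_of_forall_seriesDerivation_mem Δ (AddSubgroup.closure (Set.range f)) ?_ ?_
    (AddSubgroup.subset_closure ⟨k, rfl⟩)
  · intro g hg
    induction hg using AddSubgroup.closure_induction with
    | mem g hg => obtain ⟨k, rfl⟩ := hg; exact h0 k
    | zero => simp
    | add x y _ _ hx hy => rw [map_add, hx, hy, add_zero]
    | neg x _ hx => rw [map_neg, hx, neg_zero]
  · intro i g hg
    induction hg using AddSubgroup.closure_induction with
    | mem g hg => obtain ⟨k, rfl⟩ := hg; exact h i k
    | zero => rw [map_zero]; exact zero_mem _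
    | add x y _ _ hx hy => rw [map_add]; exact add_mem hx hy
    | neg x _ hx => rw [map_neg]; exact neg_mem hx

theorem twistedTaylor_add (ψ : S →+ A) (a b : S) :
    twistedTaylor Ω Δ ψ (a + b) = twistedTaylor Ω Δ ψ a + twistedTaylor Ω Δ ψ b := by
  ext α
  simp only [coeff_twistedTaylor, map_add, mul_add]

/-- No multinomial computation is needed. The defects `T(ab) - T(a)T(b)` have zero constant term
since `φ` is multiplicative, and by the Leibniz rule each derivation sends the defect of `(a, b)` to
the sum of those of `(a, ∂ᵢb)` and `(∂ᵢa, b)`, so all of them vanish. -/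
theorem twistedTaylor_mul [CharZero A] (φ : S →+* A) (a b : S) :
    twistedTaylor Ω Δ (φ : S →+ A) (a * b) =
      twistedTaylor Ω Δ (φ : S →+ A) a * twistedTaylor Ω Δ (φ : S →+ A) b := by
  have := eq_zero_of_seriesDerivation_mem_closure Δ (fun p : S × S =>
    twistedTaylor Ω Δ (φ : S →+ A) (p.1 * p.2) -
      twistedTaylor Ω Δ (φ : S →+ A) p.1 * twistedTaylor Ω Δ (φ : S →+ A) p.2) ?_ ?_ (a, b)
  · exact sub_eq_zero.mp this
  · intro p
    rw [map_sub, MvPowerSeries.coeff_zero_eq_constantCoeff_apply,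
      MvPowerSeries.coeff_zero_eq_constantCoeff_apply, map_mul,
      ← MvPowerSeries.coeff_zero_eq_constantCoeff_apply,
      ← MvPowerSeries.coeff_zero_eq_constantCoeff_apply,
      ← MvPowerSeries.coeff_zero_eq_constantCoeff_apply, coeff_zero_twistedTaylor,
      coeff_zero_twistedTaylor, coeff_zero_twistedTaylor]
    simp
  · rintro i ⟨x, y⟩
    refine (congrArg (· ∈ _) ?_).mpr (add_mem
      (AddSubgroup.subset_closure (Set.mem_range_self (x, Ω.der i y)))
      (AddSubgroup.subset_closure (Set.mem_range_self (Ω.der i x, y))))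
    simp only [map_sub, Derivation.leibniz, smul_eq_mul, ← twistedTaylor_der, twistedTaylor_add,
      mul_comm y]
    ring

theorem seriesDerivation_C (i : Fin m) (c : A) :
    seriesDerivation Δ i (MvPowerSeries.C c) = MvPowerSeries.C (Δ.der i c) := by
  classical
  ext α
  rw [coeff_seriesDerivation, MvPowerSeries.coeff_C, MvPowerSeries.coeff_C, MvPowerSeries.coeff_C,
    if_neg (c := α + Finsupp.single i 1 = 0) (by
      intro h; simpa using DFunLike.congr_fun h i), zero_mul, add_zero]
  split_ifs <;> simp

variable {K : Type*} [Field K] [Algebra K S] [Algebra K A] {Δ₀ : CommutingDerivations m K}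

/-- The defects `T(c) - c` are again free of constant terms and permuted by the derivations: that of
`c` goes to that of `δᵢc`. -/
theorem twistedTaylor_algebraMap [CharZero A] (hΩ : IsDifferentialAlgebra Δ₀ Ω)
    (hΔ : IsDifferentialAlgebra Δ₀ Δ) (φ : S →ₐ[K] A) (c : K) :
    twistedTaylor Ω Δ (φ : S →+ A) (algebraMap K S c) = MvPowerSeries.C (algebraMap K A c) := by
  have := eq_zero_of_seriesDerivation_mem_closure Δ (fun c : K =>
    twistedTaylor Ω Δ (φ : S →+ A) (algebraMap K S c) - MvPowerSeries.C (algebraMap K A c))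
    ?_ ?_ c
  · exact sub_eq_zero.mp this
  · intro c
    rw [map_sub, coeff_zero_twistedTaylor]
    simp
  · intro i c
    refine AddSubgroup.subset_closure ⟨Δ₀.der i c, ?_⟩
    simp only [map_sub, seriesDerivation_C, ← twistedTaylor_der, hΩ i c, hΔ i c]

/-- The twisted Taylor homomorphism `S → A[[t]]` of a `K`-algebra homomorphism `S → A`. -/
theorem exists_differentialHom_powerSeries [CharZero A] (hΩ : IsDifferentialAlgebra Δ₀ Ω)
    (hΔ : IsDifferentialAlgebra Δ₀ Δ) (φ : S →ₐ[K] A) :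
    ∃ T : S →ₐ[K] MvPowerSeries (Fin m) A,
      IsDifferentialHom Ω Δ.powerSeries (T : S →+* MvPowerSeries (Fin m) A) := by
  have h1 := twistedTaylor_algebraMap Ω Δ hΩ hΔ φ
  refine ⟨{ toFun := twistedTaylor Ω Δ (φ : S →+ A)
            map_one' := by simpa using h1 1
            map_mul' := twistedTaylor_mul Ω Δ (φ : S →+* A)
            map_zero' := by simpa using h1 0
            map_add' := twistedTaylor_add Ω Δ _
            commutes' := fun c => by rw [MvPowerSeries.algebraMap_apply]; exact h1 c },
    fun i a => twistedTaylor_der Ω Δ _ i a⟩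
end Taylor

/-! ### Restriction of power series to a line. -/

/-- A nonzero power series in several variables over an infinite field stays nonzero on a suitable
line through the origin. -/
theorem MvPowerSeries.exists_algHom_powerSeries_ne_zero {A : Type*} [Field A] [Infinite A] {m : ℕ}
    (f : MvPowerSeries (Fin m) A) (hf : f ≠ 0) :
    ∃ ρ : MvPowerSeries (Fin m) A →ₐ[A] PowerSeries A, ρ f ≠ 0 := by
  classical
  obtain ⟨α, hα⟩ : ∃ α, coeff α f ≠ 0 := by
    by_contra! h
    exact hf (MvPowerSeries.ext h)
  set n := α.degree
  set s : Finset (Fin m →₀ ℕ) := Finset.finsuppAntidiag Finset.univ n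
  have hs : ∀ β, β ∈ s ↔ β.degree = n := fun β => by
    simp [s, Finset.mem_finsuppAntidiag, Finsupp.degree_eq_sum]
  -- This is the homogeneous part of `f` in a degree `n` where it is nonzero. Along the line `t =
  -- cX` the coefficient of `X ^ n` is `P(c)`, so a non-root `c` of `P` suffices.
  let P : MvPolynomial (Fin m) A := ∑ β ∈ s, MvPolynomial.monomial β (coeff β f)
  have hP : P ≠ 0 := fun h => hα <| by
    have : MvPolynomial.coeff α P = coeff α f := by
      rw [MvPolynomial.coeff_sum, Finset.sum_eq_single α]
      · simp
      · intro β _ hβ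
        rw [MvPolynomial.coeff_monomial, if_neg hβ]
      · intro h'
        exact absurd ((hs α).mpr rfl) h'
    rw [← this, h, MvPolynomial.coeff_zero]
  obtain ⟨c, hc⟩ : ∃ c : Fin m → A, MvPolynomial.eval c P ≠ 0 := by
    by_contra! h
    exact hP (MvPolynomial.funext fun x => by rw [h, map_zero])
  let a : Fin m → MvPowerSeries Unit A := fun i => (c i) • (PowerSeries.X : PowerSeries A)
  have ha : HasSubst a := hasSubst_of_constantCoeff_zero fun i => by
    change PowerSeries.constantCoeff ((c i) • (PowerSeries.X : PowerSeries A)) = 0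
    simp
  have hprod : ∀ d : Fin m →₀ ℕ, (d.prod fun i e => a i ^ e) =
      (∏ i, c i ^ d i) • (PowerSeries.X : PowerSeries A) ^ d.degree := fun d => by
    rw [Finsupp.prod_fintype _ _ (fun _ => pow_zero _), Finsupp.degree_eq_sum,
      ← Finset.prod_pow_eq_pow_sum, ← Finset.prod_smul]
    exact Finset.prod_congr rfl fun i _ => smul_pow _ _ _
  refine ⟨substAlgHom ha, fun h => hc ?_⟩
  have h1 : PowerSeries.coeff n (subst a f : PowerSeries A) = 0 := by
    rw [← coe_substAlgHom ha, h, map_zero]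
  rw [PowerSeries.coeff, coeff_subst ha, finsum_eq_sum_of_support_subset (s := s)] at h1
  · rw [← h1, map_sum]
    refine Finset.sum_congr rfl fun d hd => ?_
    rw [hprod, MvPolynomial.eval_monomial, Finsupp.prod_fintype _ _ (fun _ => pow_zero _)]
    change _ = _ • PowerSeries.coeff n _
    rw [PowerSeries.coeff_smul, (hs d).mp hd, PowerSeries.coeff_X_pow_self, smul_eq_mul,
      smul_eq_mul, mul_one]
  · intro d hd
    by_contra hds
    apply hd
    beta_reduce
    rw [hprod]
    change _ • PowerSeries.coeff n _ = 0
    rw [PowerSeries.coeff_smul, PowerSeries.coeff_X_pow, if_neg, smul_zero, smul_zero]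
    exact fun h => hds (Finset.mem_coe.mpr ((hs d).mpr h.symm))

/-! ### Hypersurface models of finitely generated domains. -/

/-- A ring homomorphism from a subring to a field extends to the whole ring as soon as it does not
vanish at some element of the conductor. -/
theorem Subring.exists_ringHom_extension {C K : Type*} [CommRing C] [Field K] (B : Subring C)
    (ψ : B →+* K) (D : B) (hD : ψ D ≠ 0) (h : ∀ c : C, (D : C) * c ∈ B) :
    ∃ φ : C →+* K, ∀ b : B, φ b = ψ b := by
  let t : C → B := fun c => ⟨D * c, h c⟩
  have ht : ∀ b : B, t b = D * b := fun b => rfl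
  have hadd : ∀ c c', t (c + c') = t c + t c' := fun c c' => Subtype.ext (mul_add _ _ _)
  have hmul : ∀ c c', D * t (c * c') = t c * t c' := fun c c' => Subtype.ext (by
    change (D : C) * (D * (c * c')) = (D * c) * (D * c')
    ring)
  have hb : ∀ b : B, ψ (t b) / ψ D = ψ b := fun b => by
    rw [ht, map_mul, mul_div_cancel_left₀ _ hD]
  refine ⟨{ toFun := fun c => ψ (t c) / ψ D
            map_one' := by simpa using hb 1
            map_zero' := by simpa using hb 0
            map_add' := fun c c' => by rw [hadd, map_add, add_div]
            map_mul' := fun c c' => ?_ }, hb⟩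
  rw [div_mul_div_comm, ← map_mul, ← hmul, map_mul, mul_div_mul_left _ _ hD]

open Polynomial nonZeroDivisors IntermediateField in
/-- A finite extension of domains of characteristic zero is generated by one element up to a
nonzero denominator. -/
theorem exists_smul_mem_adjoin_singleton (A C : Type*) [CommRing A] [IsDomain A] [CharZero A]
    [CommRing C] [IsDomain C] [Algebra A C] [Module.Finite A C] [FaithfulSMul A C] :
    ∃ (y : C) (D : A), D ≠ 0 ∧ ∀ c : C, D • c ∈ Algebra.adjoin A {y} := by
  let F := FractionRing A
  let E := FractionRing C
  let : Algebra F E := FractionRing.liftAlgebra A E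
  have : IsScalarTower A F E := FractionRing.isScalarTower_liftAlgebra A E
  have : Algebra.IsAlgebraic A C := inferInstance
  have : IsLocalization (Algebra.algebraMapSubmonoid C A⁰) E := inferInstance
  have : FiniteDimensional F E := .of_isLocalization A C A⁰
  have : CharZero F := charZero_of_injective_algebraMap (IsFractionRing.injective A F)
  obtain ⟨α, hα⟩ := Field.exists_primitive_element F E
  obtain ⟨y, ⟨_, a, ha, rfl⟩, rfl⟩ :=
    IsLocalization.exists_mk'_eq (Algebra.algebraMapSubmonoid C A⁰) α
  have hinj : Function.Injective (algebraMap C E) := IsFractionRing.injective C E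
  have ha0 : algebraMap A F a ≠ 0 := by
    rw [Ne, map_eq_zero_iff _ (IsFractionRing.injective A F)]
    exact nonZeroDivisors.ne_zero ha
  -- The primitive element is `y / a` with `a` in `A`, so its numerator `y` is primitive too.
  have hy : F⟮algebraMap C E y⟯ = ⊤ := by
    rw [eq_top_iff, ← hα, adjoin_simple_le_iff]
    have h1 := IsLocalization.mk'_spec E y
      (⟨algebraMap A C a, a, ha, rfl⟩ : Algebra.algebraMapSubmonoid C A⁰)
    have h2 : IsLocalization.mk' E y
      (⟨algebraMap A C a, a, ha, rfl⟩ : Algebra.algebraMapSubmonoid C A⁰) =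
      (algebraMap A F a)⁻¹ • algebraMap C E y := by
      rw [eq_inv_smul_iff₀ ha0, ← h1, Algebra.smul_def, ← IsScalarTower.algebraMap_apply A F E,
        mul_comm, IsScalarTower.algebraMap_apply A C E]
    rw [h2]
    exact IntermediateField.smul_mem _ (mem_adjoin_simple_self F _)
  have key : ∀ c : C, ∃ D : A, D ≠ 0 ∧ D • c ∈ Algebra.adjoin A {y} := by
    intro c
    have hc : algebraMap C E c ∈ F⟮algebraMap C E y⟯ := by rw [hy]; trivial
    rw [← IntermediateField.mem_toSubalgebra, adjoin_simple_toSubalgebra_of_isAlgebraic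
      (Algebra.IsAlgebraic.isAlgebraic _), Algebra.adjoin_singleton_eq_range_aeval] at hc
    obtain ⟨P, hP⟩ := hc
    obtain ⟨b, hb, hb'⟩ := IsLocalization.integerNormalization_spec A⁰ P
    refine ⟨b, nonZeroDivisors.ne_zero hb, ?_⟩
    rw [Algebra.adjoin_singleton_eq_range_aeval]
    refine ⟨IsLocalization.integerNormalization A⁰ P, hinj ?_⟩
    change algebraMap C E (aeval y _) = _
    rw [← aeval_algebraMap_apply, ← aeval_map_algebraMap F, hb']
    change P.aeval _ = _ at hP
    change aeval _ (b • P) = _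
    rw [← algebraMap_smul F b P, map_smul, hP, algebraMap_smul, Algebra.smul_def, Algebra.smul_def,
      map_mul, ← IsScalarTower.algebraMap_apply]
  choose D hD0 hD using key
  obtain ⟨s, hs⟩ := Module.Finite.fg_top (R := A) (M := C)
  -- A common denominator for a finite set of module generators works for all of `C`.
  refine ⟨y, ∏ c ∈ s, D c, Finset.prod_ne_zero_iff.mpr fun c _ => hD0 c, fun c => ?_⟩
  have hle : (⊤ : Submodule A C) ≤ (Subalgebra.toSubmodule (Algebra.adjoin A {y})).comap
      (LinearMap.lsmul A C (∏ c ∈ s, D c)) := by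
    classical
    rw [← hs, Submodule.span_le]
    intro c hc
    change (∏ c ∈ s, D c) • c ∈ Algebra.adjoin A {y}
    rw [← Finset.prod_erase_mul s D hc, mul_smul]
    exact Subalgebra.smul_mem _ (hD c) _
  exact hle trivial

open Polynomial in
/-- A finitely generated domain over a field of characteristic zero is birational to a
hypersurface. -/
theorem exists_hypersurface_model {K C : Type*} [Field K] [CharZero K] [CommRing C] [IsDomain C]
    [Algebra K C] [Algebra.FiniteType K C] (h : C) (hh : h ≠ 0) :
    ∃ (d : ℕ) (g : MvPolynomial (Fin d) K →ₐ[K] C) (y : C) (F : (MvPolynomial (Fin d) K)[X])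
      (e : MvPolynomial (Fin d) K), Function.Injective g ∧ e ≠ 0 ∧
      eval₂ (g : _ →+* C) y F = 0 ∧ eval₂ (g : _ →+* C) y (derivative F) ≠ 0 ∧
      ∀ (a : Fin d → K) (b : K), eval₂ (MvPolynomial.eval a) b F = 0 →
        MvPolynomial.eval a e ≠ 0 → ∃ φ : C →ₐ[K] K, φ h ≠ 0 := by
  obtain ⟨d, g, hg, hfin⟩ := exists_finite_inj_algHom_of_fg K C
  let A := MvPolynomial (Fin d) K
  let : Algebra A C := (g : A →+* C).toAlgebra
  have : Module.Finite A C := hfin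
  have : FaithfulSMul A C := (faithfulSMul_iff_algebraMap_injective A C).mpr hg
  obtain ⟨y, D, hD0, hD⟩ := exists_smul_mem_adjoin_singleton A C
  have hy : IsIntegral A y := Algebra.IsIntegral.isIntegral y
  -- A nonzero multiple `r` of `h` lies in the Noether normalization `A`, so a point with `r ≠ 0`
  -- has `h ≠ 0`. The excluded locus `e = D * r` therefore handles both the denominator `D` and `h`.
  obtain ⟨r, hr0, h', hr⟩ := (Algebra.IsAlgebraic.isAlgebraic (R := A) h).exists_nonzero_dvd
    (mem_nonZeroDivisors_of_ne_zero hh)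
  refine ⟨d, g, y, minpoly A y, D * r, hg, mul_ne_zero hD0 hr0, minpoly.aeval A y, fun h0 => ?_,
    fun a b hab he => ?_⟩
  · have hdeg : (minpoly A y).natDegree ≠ 0 := (minpoly.natDegree_pos hy).ne'
    have h1 : derivative (minpoly A y) ≠ 0 := fun h =>
      hdeg (derivative_eq_zero.mp h)
    -- Since the polynomial ring `A` is integrally closed, the minimal polynomial divides every
    -- polynomial over `A` vanishing at `y`, which its derivative cannot do for degree reasons.
    have := natDegree_le_of_dvd (minpoly.isIntegrallyClosed_dvd hy h0) h1
    exact absurd (natDegree_derivative_lt hdeg) (by omega)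
  · rw [map_mul] at he
    -- Integral closedness also identifies `A[y]` with `A[X]` modulo the minimal polynomial, so a
    -- rational zero of the latter is a point of `A[y]`.
    let ψ : Algebra.adjoin A {y} →+* K := (AdjoinRoot.lift (MvPolynomial.eval a) b hab).comp
      (minpoly.equivAdjoin hy).symm.toRingEquiv.toRingHom
    have hψ : ∀ p : A, ψ (algebraMap A _ p) = MvPolynomial.eval a p := fun p => by
      change AdjoinRoot.lift (MvPolynomial.eval a) b hab
        ((minpoly.equivAdjoin hy).symm (algebraMap A _ p)) = _
      rw [AlgEquiv.commutes]
      exact AdjoinRoot.lift_of hab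
    obtain ⟨φ, hφ⟩ := Subring.exists_ringHom_extension (Algebra.adjoin A {y}).toSubring ψ
      (algebraMap A (Algebra.adjoin A {y}) D) (by rw [hψ]; exact left_ne_zero_of_mul he) (fun c => by
        have := hD c
        rwa [Algebra.smul_def] at this)
    have hφA : ∀ p : A, φ (algebraMap A C p) = MvPolynomial.eval a p := fun p =>
      (hφ (algebraMap A (Algebra.adjoin A {y}) p)).trans (hψ p)
    refine ⟨{ φ with commutes' := fun c => ?_ }, fun h0 => ?_⟩
    · change φ (algebraMap K C c) = c
      rw [← g.commutes c]
      exact (hφA _).trans (by simp [MvPolynomial.algebraMap_eq])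
    · change φ h = 0 at h0
      have := hφA r
      rw [hr, map_mul, h0, zero_mul] at this
      exact right_ne_zero_of_mul he this.symm

/-! ### From approximate power series points to rational points. -/

section HypersurfacePoints
open Polynomial

/-- Evaluation of a polynomial in `d + 1` variables at a point of a `K`-algebra. -/
noncomputable def evalAt {K R : Type*} [Field K] [CommRing R] [Algebra K R] {d : ℕ}
    (ξ : Fin d → R) (η : R) : (MvPolynomial (Fin d) K)[X] →+* R :=
  eval₂RingHom (MvPolynomial.aeval ξ : MvPolynomial (Fin d) K →ₐ[K] R).toRingHom η

variable {K : Type*} [Field K] {R R' : Type*} [CommRing R] [Algebra K R] [CommRing R']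
  [Algebra K R'] {d : ℕ}

theorem evalAt_C (ξ : Fin d → R) (η : R) (p : MvPolynomial (Fin d) K) :
    evalAt ξ η (C p) = MvPolynomial.aeval ξ p := by
  simp [evalAt]

theorem map_evalAt (f : R →ₐ[K] R') (ξ : Fin d → R) (η : R) (F : (MvPolynomial (Fin d) K)[X]) :
    f (evalAt ξ η F) = evalAt (fun i => f (ξ i)) (f η) F := by
  have : (f : R →+* R').comp (evalAt (K := K) ξ η) = evalAt (fun i => f (ξ i)) (f η) := by
    refine Polynomial.ringHom_ext' (MvPolynomial.ringHom_ext (fun c => ?_) fun i => ?_) ?_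
    · simp [evalAt]
    · simp [evalAt]
    · simp [evalAt]
  exact congrArg (fun g : _ →+* R' => g F) this

theorem evalAt_sub_mem (I : Ideal R) {ξ ξ' : Fin d → R} {η η' : R} (hξ : ∀ i, ξ i - ξ' i ∈ I)
    (hη : η - η' ∈ I) (F : (MvPolynomial (Fin d) K)[X]) : evalAt ξ η F - evalAt ξ' η' F ∈ I := by
  rw [← Ideal.Quotient.eq]
  change Ideal.Quotient.mkₐ K I _ = Ideal.Quotient.mkₐ K I _
  rw [map_evalAt, map_evalAt]
  congr 1
  · congr 1
    · funext i
      exact Ideal.Quotient.eq.mpr (hξ i)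
    · exact Ideal.Quotient.eq.mpr hη

/-- An approximate power series point of a hypersurface over a large field, with precision better
than twice the order of the partial derivative, can be moved to a rational point. -/
theorem IsLargeField.exists_point_of_polynomial_approx (hK : IsLargeField K)
    (F : (MvPolynomial (Fin d) K)[X]) (x : Fin d → K[X]) (y : K[X]) (r : ℕ)
    (h0 : X ^ (2 * r + 1) ∣ evalAt x y F) (h1 : X ^ r ∣ evalAt x y (derivative F))
    (h1' : (evalAt x y (derivative F)).coeff r ≠ 0) (e : MvPolynomial (Fin d) K)
    (he : MvPolynomial.aeval x e ≠ 0) :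
    ∃ (a : Fin d → K) (b : K), evalAt a b F = 0 ∧ MvPolynomial.eval a e ≠ 0 := by
  obtain ⟨g₀, hg₀⟩ := h0
  obtain ⟨u, hu⟩ := h1
  have hu0 : u.eval 0 ≠ 0 := by
    rw [hu, coeff_X_pow_mul'] at h1'
    simpa [coeff_zero_eq_eval_zero] using h1'
  let f : K[X][X] := F.map (MvPolynomial.aeval x : MvPolynomial (Fin d) K →ₐ[K] K[X]).toRingHom
  have hf0 : f.eval y = evalAt x y F := eval_map _ _
  have hf1 : (derivative f).eval y = evalAt x y (derivative F) := by
    rw [derivative_map]; exact eval_map _ _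
  -- Newton's substitution: with `Z` the outer variable, put `y + X^r Z` for `y`. All terms of the
  -- expansion are then divisible by `X^(2r)`, and the quotient `G = X g₀ + u Z + k Z²` vanishes at
  -- the origin with `∂G/∂Z = u(0) ≠ 0` there. A zero of `G` gives a zero of `F`.
  obtain ⟨k, hk⟩ := binomExpansion (f.map (C : K[X] →+* K[X][X])) (C y) (C (X ^ r) * X)
  rw [derivative_map, eval_map_apply, eval_map_apply, hf0, hf1, hg₀, hu] at hk
  set G : K[X][X] := C (X * g₀) + C u * X + k * X ^ 2 with hG
  have hk' : (f.map (C : K[X] →+* K[X][X])).eval (C y + C (X ^ r) * X) =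
      C (X ^ (2 * r)) * G := by
    rw [hk, hG]
    simp only [map_mul, map_pow]
    ring
  obtain ⟨a, b, hab, hea⟩ := hK.exists_evalEval_eq_zero G (by simp [hG, evalEval])
    (by simpa [hG, evalEval] using hu0)
    (X * MvPolynomial.aeval x e) (mul_ne_zero X_ne_zero he)
  let σ : K[X][X] →ₐ[K] K := { evalEvalRingHom a b with commutes' := fun c => by simp }
  have hσC : ∀ p : K[X], σ (C p) = p.eval a := fun p => evalEval_C _ _ _
  have hσX : σ X = b := evalEval_X _ _
  have hmap : (f.map (C : K[X] →+* K[X][X])).eval (C y + C (X ^ r) * X) =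
      evalAt (fun i => C (x i)) (C y + C (X ^ r) * X) F := by
    rw [eval_map, eval₂_map, evalAt, coe_eval₂RingHom]
    congr 1
    refine MvPolynomial.ringHom_ext (fun c => ?_) fun i => ?_
    · simp [Polynomial.algebraMap_apply]
    · simp
  refine ⟨fun i => (x i).eval a, y.eval a + a ^ r * b, ?_, ?_⟩
  · have h := congrArg σ (hmap.symm.trans hk')
    rw [map_evalAt, map_mul, show σ G = 0 from hab, mul_zero] at h
    simpa [hσC, hσX] using h
  · rw [eval_mul] at hea
    have h := right_ne_zero_of_mul hea
    have h2 : (MvPolynomial.aeval x e).eval a = MvPolynomial.eval (fun i => (x i).eval a) e := by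
      have := map_evalAt (Polynomial.aeval a : K[X] →ₐ[K] K) x 0 (C e)
      rw [evalAt_C, evalAt_C] at this
      exact this
    rwa [h2] at h

theorem PowerSeries.sub_trunc_mem_span (N : ℕ) (p : PowerSeries K) :
    ((PowerSeries.trunc N p : K[X]) : PowerSeries K) - p ∈
      Ideal.span {(PowerSeries.X : PowerSeries K) ^ N} := by
  rw [Ideal.mem_span_singleton, PowerSeries.X_pow_dvd_iff]
  intro m hm
  rw [map_sub, Polynomial.coeff_coe, PowerSeries.coeff_trunc, if_pos hm, sub_self]

theorem IsLargeField.exists_point_of_powerSeries_approx (hK : IsLargeField K)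
    (F : (MvPolynomial (Fin d) K)[X]) (ξ : Fin d → PowerSeries K) (η : PowerSeries K) (r : ℕ)
    (h0 : ∀ k < 2 * r + 1, PowerSeries.coeff k (evalAt ξ η F) = 0)
    (h1 : ∀ k < r, PowerSeries.coeff k (evalAt ξ η (derivative F)) = 0)
    (h1' : PowerSeries.coeff r (evalAt ξ η (derivative F)) ≠ 0) (e : MvPolynomial (Fin d) K)
    (he : MvPolynomial.aeval ξ e ≠ 0) :
    ∃ (a : Fin d → K) (b : K), evalAt a b F = 0 ∧ MvPolynomial.eval a e ≠ 0 := by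
  obtain ⟨q, hq⟩ : ∃ q, PowerSeries.coeff q (MvPolynomial.aeval ξ e) ≠ 0 := by
    by_contra! h
    exact he (PowerSeries.ext h)
  -- Truncating at `N` preserves the coefficients up to `2r`, which carry the approximation
  -- hypotheses, and the coefficient `q` witnessing that `e` does not vanish.
  let N := 2 * r + q + 1
  let x : Fin d → K[X] := fun i => PowerSeries.trunc N (ξ i)
  let y : K[X] := PowerSeries.trunc N η
  have key : ∀ (P : (MvPolynomial (Fin d) K)[X]) (k : ℕ), k < N →
      (evalAt x y P).coeff k = PowerSeries.coeff k (evalAt ξ η P) := fun P k hk => by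
    have h := evalAt_sub_mem (Ideal.span {(PowerSeries.X : PowerSeries K) ^ N})
      (fun i => PowerSeries.sub_trunc_mem_span N (ξ i)) (PowerSeries.sub_trunc_mem_span N η) P
    rw [Ideal.mem_span_singleton, PowerSeries.X_pow_dvd_iff] at h
    have h2 := h k hk
    have h3 := map_evalAt (Polynomial.coeToPowerSeries.algHom (R := K) K) x y P
    simp only [Polynomial.coeToPowerSeries.algHom_apply, Algebra.algebraMap_self,
      PowerSeries.map_id, id_eq] at h3
    rw [← h3, map_sub, Polynomial.coeff_coe] at h2
    exact sub_eq_zero.mp h2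
  refine hK.exists_point_of_polynomial_approx F x y r ?_ ?_ ?_ e ?_
  · rw [X_pow_dvd_iff]
    intro k hk
    rw [key F k (by omega), h0 k hk]
  · rw [X_pow_dvd_iff]
    intro k hk
    rw [key _ k (by omega), h1 k hk]
  · rwa [key _ r (by omega)]
  · intro h
    apply hq
    have := key (C e) q (by omega)
    rwa [evalAt_C, evalAt_C, h, coeff_zero, eq_comm] at this
end HypersurfacePoints

/-! ### Points of algebras inside power series over an ultrapower. -/

section Ultrapower
open Filter Polynomial
variable {ι K : Type*} [Field K]

/-- The diagonal algebra structure on a ring of germs. -/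
noncomputable instance Filter.Germ.instAlgebraDiagonal (l : Filter ι) : Algebra K (Germ l K) where
  algebraMap := (Germ.coeRingHom l).comp (Pi.constRingHom ι K)
  commutes' _ _ := mul_comm _ _
  smul_def' _ x := Germ.inductionOn x fun _ => rfl

/-- The projection from the power to a ring of germs, as an algebra homomorphism. -/
noncomputable def Filter.Germ.coeAlgHom (K : Type*) [Field K] (l : Filter ι) :
    (ι → K) →ₐ[K] Germ l K :=
  { Germ.coeRingHom l with commutes' := fun _ => rfl }

theorem Filter.Germ.coeAlgHom_eq_zero_iff (l : Filter ι) (a : ι → K) :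
    Germ.coeAlgHom K l a = 0 ↔ ∀ᶠ i in l, a i = 0 :=
  Germ.coe_eq

theorem Filter.Germ.coeAlgHom_surjective (l : Filter ι) :
    Function.Surjective (Germ.coeAlgHom K l) := fun x => Germ.inductionOn x fun a => ⟨a, rfl⟩

instance Filter.Germ.instCharZeroDiagonal [CharZero K] (U : Ultrafilter ι) :
    CharZero (Germ (U : Filter ι) K) :=
  charZero_of_injective_algebraMap (algebraMap K (Germ (U : Filter ι) K)).injective

variable {U : Ultrafilter ι}

/-- A finitely generated algebra over a large field `K` which embeds into the power series over an
ultrapower of `K` has a `K`-point outside any given hypersurface. -/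
theorem IsLargeField.exists_algHom_of_injective [CharZero K] (hK : IsLargeField K) {C : Type*}
    [CommRing C] [IsDomain C] [Algebra K C] [Algebra.FiniteType K C]
    (ρ : C →ₐ[K] PowerSeries (Germ (U : Filter ι) K)) (hρ : Function.Injective ρ) (h : C)
    (hh : h ≠ 0) : ∃ φ : C →ₐ[K] K, φ h ≠ 0 := by
  obtain ⟨d, g, y, F, e, hg, he, hF, hF', H⟩ := exists_hypersurface_model (K := K) h hh
  have hg' : MvPolynomial.aeval (fun i => g (MvPolynomial.X i)) = g :=
    (MvPolynomial.aeval_unique g).symm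
  have hev : ∀ P : (MvPolynomial (Fin d) K)[X], evalAt (fun i => ρ (g (MvPolynomial.X i))) (ρ y) P =
      ρ (eval₂ (g : _ →+* C) y P) := fun P => by
    rw [← map_evalAt, evalAt, coe_eval₂RingHom, hg']
    rfl
  let π := PowerSeries.mapAlgHom (Germ.coeAlgHom K (U : Filter ι))
  let ε : ι → PowerSeries (ι → K) →ₐ[K] PowerSeries K := fun i =>
    PowerSeries.mapAlgHom (Pi.evalAlgHom K (fun _ => K) i)
  have hπ : Function.Surjective π := fun f => by
    choose a ha using fun n => Germ.coeAlgHom_surjective (U : Filter ι) (PowerSeries.coeff n f)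
    exact ⟨PowerSeries.mk a, PowerSeries.ext fun n => by
      simp [π, PowerSeries.mapAlgHom_apply, ha]⟩
  choose ξ hξ using fun i => hπ (ρ (g (MvPolynomial.X i)))
  obtain ⟨η, hη⟩ := hπ (ρ y)
  -- Łoś's principle for one coefficient: lift the series along `π` to series over `ι → K` and read
  -- off the components by `ε i`.
  have key : ∀ (P : (MvPolynomial (Fin d) K)[X]) (k : ℕ),
      PowerSeries.coeff k (ρ (eval₂ (g : _ →+* C) y P)) = 0 ↔
      ∀ᶠ i in (U : Filter ι),
        PowerSeries.coeff k (evalAt (fun j => ε i (ξ j)) (ε i η) P) = 0 := fun P k => by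
    rw [← hev]
    simp_rw [← hξ, ← hη, ← map_evalAt]
    exact Germ.coeAlgHom_eq_zero_iff (U : Filter ι) (PowerSeries.coeff k (evalAt ξ η P))
  have hex : ∀ p : PowerSeries (Germ (U : Filter ι) K), p ≠ 0 → ∃ r,
      PowerSeries.coeff r p ≠ 0 ∧ ∀ k < r, PowerSeries.coeff k p = 0 := fun p hp => by
    classical
    have : ∃ r, PowerSeries.coeff r p ≠ 0 := by
      by_contra! h
      exact hp (PowerSeries.ext h)
    exact ⟨Nat.find this, Nat.find_spec this, fun k hk => not_not.mp (Nat.find_min this hk)⟩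
  obtain ⟨r, hr, hr'⟩ := hex _ ((map_ne_zero_iff ρ hρ).mpr hF')
  have he' : ρ (eval₂ (g : _ →+* C) y (Polynomial.C e)) ≠ 0 := by
    rw [eval₂_C]
    exact (map_ne_zero_iff ρ hρ).mpr ((map_ne_zero_iff g hg).mpr he)
  obtain ⟨q, hq, -⟩ := hex _ he'
  -- The ultrafilter handles only finitely many coefficients at once, so the exact zero of `F`
  -- becomes an approximate one in the components. The precision `2r + 1` is what the Newton
  -- argument needs, `r` being the order of the derivative.
  have e0 : ∀ᶠ i in (U : Filter ι), ∀ k ∈ Finset.range (2 * r + 1),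
      PowerSeries.coeff k (evalAt (fun j => ε i (ξ j)) (ε i η) F) = 0 := by
    rw [Filter.eventually_all_finset]
    intro k _
    rw [← key, hF, map_zero, map_zero]
  have e1 : ∀ᶠ i in (U : Filter ι), ∀ k ∈ Finset.range r,
      PowerSeries.coeff k (evalAt (fun j => ε i (ξ j)) (ε i η) (derivative F)) = 0 := by
    rw [Filter.eventually_all_finset]
    intro k hk
    rw [← key]
    exact hr' k (Finset.mem_range.mp hk)
  have e2 := Ultrafilter.eventually_not.mpr ((key _ _).not.mp hr)
  have e3 := Ultrafilter.eventually_not.mpr ((key _ _).not.mp hq)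
  obtain ⟨i, ⟨⟨h0, h1⟩, h2⟩, h3⟩ := (((e0.and e1).and e2).and e3).exists
  obtain ⟨a, b, hab, hea⟩ := hK.exists_point_of_powerSeries_approx F (fun j => ε i (ξ j)) (ε i η) r
    (fun k hk => h0 k (Finset.mem_range.mpr hk)) (fun k hk => h1 k (Finset.mem_range.mpr hk)) h2 e
    (fun h => h3 (by rw [evalAt_C, h, map_zero]))
  exact H a b hab hea

/-- A finitely generated algebra over a large field `K` with a homomorphism to the power series
over an ultrapower of `K` has a `K`-point at which a given element is nonzero, provided that
the element has nonzero image. -/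
theorem IsLargeField.exists_algHom_of_algHom_powerSeries [CharZero K] (hK : IsLargeField K)
    {C : Type*} [CommRing C] [Algebra K C] [Algebra.FiniteType K C]
    (ρ : C →ₐ[K] PowerSeries (Germ (U : Filter ι) K)) (h : C)
    (hh : ρ h ≠ 0) : ∃ φ : C →ₐ[K] K, φ h ≠ 0 := by
  have : Algebra.FiniteType K ρ.range :=
    Algebra.FiniteType.of_surjective ρ.rangeRestrict ρ.rangeRestrict_surjective
  obtain ⟨φ, hφ⟩ := hK.exists_algHom_of_injective ρ.range.val Subtype.val_injective
    (ρ.rangeRestrict h) (fun h0 => hh (congrArg Subtype.val h0))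
  exact ⟨φ.comp ρ.rangeRestrict, hφ⟩
end Ultrapower

/-! ### Extending points along a well-ordered family of generators. -/

section Graph
variable {K R : Type*} [Field K] [CommRing R] [Algebra K R]

/-- A subalgebra of `R × K` is functional if it is the graph of a partial homomorphism `R → K`. -/
def IsFunctional (Γ : Subalgebra K (R × K)) : Prop := ∀ k : K, ((0 : R), k) ∈ Γ → k = 0

theorem IsFunctional.injective_fst {Γ : Subalgebra K (R × K)} (hΓ : IsFunctional Γ) :
    Function.Injective ((AlgHom.fst K R K).comp Γ.val) := by
  rw [injective_iff_map_eq_zero]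
  rintro ⟨⟨r, k⟩, hz⟩ h
  obtain rfl : r = 0 := h
  obtain rfl := hΓ k hz
  rfl

-- An element `(0, k)` of the enlarged algebra is `p(s, a)` for a polynomial `p` over `Γ`. As `Γ`
-- projects injectively to `R`, transcendence of `s` forces `p = 0`, whatever the value `a`.
open Polynomial in
theorem IsFunctional.adjoin_of_transcendental {Γ : Subalgebra K (R × K)} (hΓ : IsFunctional Γ)
    (s : R) (hs : Transcendental (Γ.map (AlgHom.fst K R K)) s) (a : K) :
    IsFunctional (Algebra.adjoin K (insert (s, a) (Γ : Set (R × K)))) := by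
  intro k hk
  have key : ∀ z ∈ Algebra.adjoin K (insert (s, a) (Γ : Set (R × K))),
      ∃ p : Γ[X], eval₂RingHom (Γ.val : Γ →+* R × K) (s, a) p = z := by
    intro z hz
    induction hz using Algebra.adjoin_induction with
    | mem z hz =>
      obtain rfl | hz := hz
      · exact ⟨X, by simp⟩
      · exact ⟨C ⟨z, hz⟩, by simp⟩
    | algebraMap c => exact ⟨C (algebraMap K Γ c), by simp⟩
    | add z w _ _ hz hw =>
      obtain ⟨p, rfl⟩ := hz
      obtain ⟨q, rfl⟩ := hw
      exact ⟨p + q, map_add _ _ _⟩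
    | mul z w _ _ hz hw =>
      obtain ⟨p, rfl⟩ := hz
      obtain ⟨q, rfl⟩ := hw
      exact ⟨p * q, map_mul _ _ _⟩
  obtain ⟨p, hp⟩ := key _ hk
  let f : Γ →+* Γ.map (AlgHom.fst K R K) :=
    (((AlgHom.fst K R K).comp Γ.val).codRestrict (Γ.map (AlgHom.fst K R K))
      fun z => ⟨z, z.2, rfl⟩).toRingHom
  have hf : Function.Injective f := fun z w h => hΓ.injective_fst (congrArg Subtype.val h)
  have h0 : aeval s (p.map f) = 0 := by
    have h1 := congrArg (RingHom.fst R K) hp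
    rw [coe_eval₂RingHom, hom_eval₂] at h1
    rw [aeval_def, eval₂_map]
    exact h1
  have hp0 : p = 0 := by
    rw [transcendental_iff] at hs
    exact (Polynomial.map_eq_zero_iff hf).mp (hs _ h0)
  rw [hp0, map_zero] at hp
  exact (congrArg Prod.snd hp).symm

/-- The value `l / k` at `s` is forced by the values at `η` and `η * s`. Powers of `(η, k)` move
every element of the enlarged algebra into `Γ`, and `(0, c)` goes to `(0, k ^ n * c)`, where `k` is
invertible. -/
theorem IsFunctional.adjoin_of_mul_mem [IsDomain R] {Γ : Subalgebra K (R × K)}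
    (hΓ : IsFunctional Γ) {η s : R} {k l : K} (hk : k ≠ 0) (hη : (η, k) ∈ Γ)
    (hs : (η * s, l) ∈ Γ) :
    IsFunctional (Algebra.adjoin K (insert (s, l / k) (Γ : Set (R × K)))) := by
  have key : ∀ z ∈ Algebra.adjoin K (insert (s, l / k) (Γ : Set (R × K))),
      ∃ n : ℕ, (η, k) ^ n * z ∈ Γ := by
    intro z hz
    induction hz using Algebra.adjoin_induction with
    | mem z hz =>
      obtain rfl | hz := hz
      · refine ⟨1, ?_⟩
        rw [pow_one, Prod.mk_mul_mk, mul_div_cancel₀ _ hk]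
        exact hs
      · exact ⟨0, by simpa using hz⟩
    | algebraMap c => exact ⟨0, by rw [pow_zero, one_mul]; exact Γ.algebraMap_mem c⟩
    | add z w _ _ hz hw =>
      obtain ⟨n, hn⟩ := hz
      obtain ⟨n', hn'⟩ := hw
      refine ⟨n + n', ?_⟩
      have h1 : (η, k) ^ (n + n') * (z + w) =
        (η, k) ^ n' * ((η, k) ^ n * z) + (η, k) ^ n * ((η, k) ^ n' * w) := by ring
      rw [h1]
      exact add_mem (mul_mem (pow_mem hη _) hn) (mul_mem (pow_mem hη _) hn')
    | mul z w _ _ hz hw =>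
      obtain ⟨n, hn⟩ := hz
      obtain ⟨n', hn'⟩ := hw
      refine ⟨n + n', ?_⟩
      have h1 : (η, k) ^ (n + n') * (z * w) = ((η, k) ^ n * z) * ((η, k) ^ n' * w) := by ring
      rw [h1]
      exact mul_mem hn hn'
  intro c hc
  obtain ⟨n, hn⟩ := key _ hc
  rw [Prod.pow_mk, Prod.mk_mul_mk, mul_zero] at hn
  exact (mul_eq_zero.mp (hΓ _ hn)).resolve_left (pow_ne_zero n hk)

theorem isFunctional_iSup_of_directed {κ : Type*} [Nonempty κ] {Γ : κ → Subalgebra K (R × K)}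
    (hdir : Directed (· ≤ ·) Γ) (hΓ : ∀ i, IsFunctional (Γ i)) : IsFunctional (⨆ i, Γ i) := by
  intro k hk
  rw [← SetLike.mem_coe, Subalgebra.coe_iSup_of_directed hdir, Set.mem_iUnion] at hk
  obtain ⟨i, hi⟩ := hk
  exact hΓ i k hi

theorem IsFunctional.nonempty_algHom {Γ : Subalgebra K (R × K)} (hΓ : IsFunctional Γ)
    {B : Subalgebra K R} (hB : B ≤ Γ.map (AlgHom.fst K R K)) : Nonempty (B →ₐ[K] K) := by
  let e := AlgEquiv.ofInjective _ hΓ.injective_fst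
  have hB' : B ≤ ((AlgHom.fst K R K).comp Γ.val).range := fun b hb => by
    obtain ⟨z, hz, rfl⟩ := hB hb
    exact ⟨⟨z, hz⟩, rfl⟩
  exact ⟨(((AlgHom.snd K R K).comp Γ.val).comp (e.symm : _ →ₐ[K] Γ)).comp
    (Subalgebra.inclusion hB')⟩

variable {Y : Type*} [LinearOrder Y] [WellFoundedLT Y] [IsDomain R] (x : Y → R)

/-- Extension of a `K`-point along a well-ordered family of generators, each of which is either
transcendental over the preceding ones or a fraction with a fixed denominator. -/
theorem exists_algHom_adjoin_range (I₀ : Set Y) (hI₀ : IsLowerSet I₀)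
    (φ : Algebra.adjoin K (x '' I₀) →ₐ[K] K) (η : Algebra.adjoin K (x '' I₀)) (hη : φ η ≠ 0)
    (hstep : ∀ v ∉ I₀, Transcendental (Algebra.adjoin K (x '' Set.Iio v)) (x v) ∨
      (η : R) * x v ∈ Algebra.adjoin K (x '' Set.Iio v)) :
    Nonempty (Algebra.adjoin K (Set.range x) →ₐ[K] K) := by
  let Γ₀ : Subalgebra K (R × K) := (AlgHom.prod (Algebra.adjoin K (x '' I₀)).val φ).range
  -- Zorn's lemma is applied to initial segments `I` paired with the graph of an extension of `φ` to
  -- the algebra generated by `x '' I`. Using graphs makes unions of chains suprema of subalgebras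
  -- of `R × K`.
  let 𝓢 : Set (Set Y × Subalgebra K (R × K)) := {p | IsLowerSet p.1 ∧ I₀ ⊆ p.1 ∧ Γ₀ ≤ p.2 ∧
    IsFunctional p.2 ∧ p.2.map (AlgHom.fst K R K) = Algebra.adjoin K (x '' p.1)}
  have h₀ : (I₀, Γ₀) ∈ 𝓢 := by
    refine ⟨hI₀, le_rfl, le_rfl, ?_, ?_⟩
    · rintro k ⟨b, hb⟩
      have h1 : (b : R) = 0 := congrArg Prod.fst hb
      have h2 : φ b = k := congrArg Prod.snd hb
      rw [← h2, show b = 0 from Subtype.ext h1, map_zero]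
    · ext r
      constructor
      · rintro ⟨_, ⟨b, rfl⟩, rfl⟩
        exact b.2
      · intro hr
        exact ⟨_, ⟨⟨r, hr⟩, rfl⟩, rfl⟩
  obtain ⟨⟨I, Γ⟩, hle, hmax⟩ := zorn_le_nonempty₀ 𝓢 (fun c hc hchain p hp => by
    have hne : Nonempty c := ⟨⟨p, hp⟩⟩
    have hdir : Directed (· ≤ ·) fun q : c => q.1.2 := fun q q' => by
      obtain h | h := hchain.total q.2 q'.2
      · exact ⟨q', h.2, le_rfl⟩
      · exact ⟨q, le_rfl, h.2⟩
    refine ⟨(⋃ q : c, q.1.1, ⨆ q : c, q.1.2), ⟨?_, ?_, ?_, ?_, ?_⟩, fun q hq =>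
      ⟨Set.subset_iUnion (fun q : c => q.1.1) ⟨q, hq⟩, le_iSup (fun q : c => q.1.2) ⟨q, hq⟩⟩⟩
    · exact isLowerSet_iUnion fun q => (hc q.2).1
    · exact (hc hp).2.1.trans (Set.subset_iUnion (fun q : c => q.1.1) ⟨p, hp⟩)
    · exact (hc hp).2.2.1.trans (le_iSup (fun q : c => q.1.2) ⟨p, hp⟩)
    · exact isFunctional_iSup_of_directed hdir fun q => (hc q.2).2.2.2.1
    · apply le_antisymm
      · rintro _ ⟨z, hz, rfl⟩
        change z ∈ ((⨆ q : c, q.1.2 : Subalgebra K (R × K)) : Set (R × K)) at hz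
        rw [Subalgebra.coe_iSup_of_directed hdir, Set.mem_iUnion] at hz
        obtain ⟨q, hq⟩ := hz
        have : z.1 ∈ Subalgebra.map (AlgHom.fst K R K) q.1.2 := ⟨z, hq, rfl⟩
        rw [(hc q.2).2.2.2.2] at this
        exact Algebra.adjoin_mono (Set.image_mono (Set.subset_iUnion (fun q : c => q.1.1) q)) this
      · rw [Algebra.adjoin_le_iff]
        rintro _ ⟨i, hi, rfl⟩
        obtain ⟨q, hq⟩ := Set.mem_iUnion.mp hi
        have : x i ∈ Algebra.adjoin K (x '' q.1.1) := Algebra.subset_adjoin ⟨i, hq, rfl⟩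
        rw [← (hc q.2).2.2.2.2] at this
        exact Subalgebra.map_mono (le_iSup (fun q : c => q.1.2) q) this) _ h₀
  obtain ⟨⟨hI, hI₀I, hΓ₀, hΓ, hfst⟩, hmax⟩ := hmax
  dsimp only at hI hI₀I hΓ₀ hΓ hfst
  have huniv : I = Set.univ := by
    by_contra hne
    obtain ⟨v, hv, hvmin⟩ := WellFounded.has_min (wellFounded_lt (α := Y)) Iᶜ
      (Set.nonempty_compl.mpr hne)
    -- Minimality of `v` outside the lower set `I` makes `I` the set of predecessors of `v`, which
    -- is the form `hstep` speaks about.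
    have hIv : I = Set.Iio v := Set.ext fun i =>
      ⟨fun hi => lt_of_not_ge fun h => hv (hI h hi), fun hi => by
        by_contra h
        exact hvmin i h hi⟩
    obtain ⟨a, ha⟩ : ∃ a : K,
        IsFunctional (Algebra.adjoin K (insert (x v, a) (Γ : Set (R × K)))) := by
      obtain h | h := hstep v fun h => hv (hI₀I h)
      · rw [← hIv, ← hfst] at h
        exact ⟨0, hΓ.adjoin_of_transcendental _ h 0⟩
      · rw [← hIv, ← hfst] at h
        obtain ⟨⟨r, l⟩, hrl, hr⟩ := h
        obtain rfl : r = η * x v := hr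
        exact ⟨l / φ η, hΓ.adjoin_of_mul_mem hη (hΓ₀ ⟨η, rfl⟩) hrl⟩
    have hmem : (insert v I, Algebra.adjoin K (insert (x v, a) (Γ : Set (R × K)))) ∈ 𝓢 := by
      have hΓle : Γ ≤ Algebra.adjoin K (insert (x v, a) (Γ : Set (R × K))) := fun z hz =>
        Algebra.subset_adjoin (Set.mem_insert_of_mem _ hz)
      refine ⟨?_, hI₀I.trans (Set.subset_insert _ _), hΓ₀.trans hΓle, ha, ?_⟩
      · rw [hIv, Set.Iio_insert]
        exact isLowerSet_Iic v
      · rw [AlgHom.map_adjoin]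
        apply le_antisymm
        · rw [Algebra.adjoin_le_iff]
          rintro _ ⟨z, rfl | hz, rfl⟩
          · exact Algebra.subset_adjoin ⟨v, Set.mem_insert _ _, rfl⟩
          · have : z.1 ∈ Γ.map (AlgHom.fst K R K) := ⟨z, hz, rfl⟩
            rw [hfst] at this
            exact Algebra.adjoin_mono (Set.image_mono (Set.subset_insert _ _)) this
        · rw [Algebra.adjoin_le_iff]
          rintro _ ⟨i, rfl | hi, rfl⟩
          · exact Algebra.subset_adjoin ⟨_, Set.mem_insert _ _, rfl⟩
          · have : x i ∈ Algebra.adjoin K (x '' I) := Algebra.subset_adjoin ⟨i, hi, rfl⟩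
            rw [← hfst] at this
            obtain ⟨z, hz, hz'⟩ := this
            exact Algebra.subset_adjoin ⟨z, Set.mem_insert_of_mem _ hz, hz'⟩
    have := (hmax hmem ⟨Set.subset_insert _ _, fun z hz =>
        Algebra.subset_adjoin (Set.mem_insert_of_mem _ hz)⟩).1
    exact hv (this (Set.mem_insert v I))
  rw [huniv, Set.image_univ] at hfst
  exact hΓ.nonempty_algHom hfst.ge
end Graph

/-! ### Leaders and separants. -/

section Leaders
open Polynomial

/-- Differentiating `p(r)`, up to a member of a subalgebra containing `r` and the derivatives of
the coefficients of `p`, amounts to multiplying the derivative of `r` by `p'(r)`. -/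
theorem Derivation.aeval_sub_mem {K R : Type*} [Field K] [CommRing R] [Algebra K R]
    (d : SelfDerivation R) (B B' : Subalgebra K R) (hd : ∀ b ∈ B, d b ∈ B')
    (r : R) (hr : r ∈ B') (p : B[X]) : d (aeval r p) - aeval r (derivative p) * d r ∈ B' := by
  induction p using Polynomial.induction_on' with
  | add p q hp hq =>
    have : d (aeval r (p + q)) - aeval r (derivative (p + q)) * d r =
      (d (aeval r p) - aeval r (derivative p) * d r) +
      (d (aeval r q) - aeval r (derivative q) * d r) := by
      simp only [map_add]; ring
    rw [this]
    exact add_mem hp hq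
  | monomial n b =>
    have : d (aeval r (monomial n b)) - aeval r (derivative (monomial n b)) * d r =
        r ^ n * d b := by
      rw [aeval_monomial, derivative_monomial, aeval_monomial, Derivation.leibniz,
        Derivation.leibniz_pow, map_mul]
      simp only [smul_eq_mul, nsmul_eq_mul]
      change (b : R) * _ + r ^ n * d b - (b : R) * (n : R) * _ * _ = _
      ring
    rw [this]
    exact mul_mem (pow_mem hr n) (hd _ b.2)

variable {m : ℕ} {K R : Type*} [Field K] [CommRing R] [Algebra K R]
  {Δ : CommutingDerivations m K} {Ω : CommutingDerivations m R}

theorem IsDifferentialAlgebra.der_mem_adjoin (hΩ : IsDifferentialAlgebra Δ Ω)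
    {t : Set R} {B : Subalgebra K R} (i : Fin m)
    (ht : t ⊆ B) (hd : ∀ a ∈ t, Ω.der i a ∈ B) {a : R} (ha : a ∈ Algebra.adjoin K t) :
    Ω.der i a ∈ B := by
  have hle : Algebra.adjoin K t ≤ B := Algebra.adjoin_le ht
  induction ha using Algebra.adjoin_induction with
  | mem a ha => exact hd a ha
  | algebraMap c => rw [← hΩ i c]; exact B.algebraMap_mem _
  | add a b _ _ ha hb => rw [map_add]; exact add_mem ha hb
  | mul a b ha' hb' ha hb =>
    rw [Derivation.leibniz, smul_eq_mul, smul_eq_mul]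
    exact add_mem (mul_mem (hle ha') hb) (mul_mem (hle hb') ha)

variable {Y : Type*} [LinearOrder Y]

theorem der_mem_adjoin_Iio (hΩ : IsDifferentialAlgebra Δ Ω) (x : Y → R)
    (shift : Fin m → Y → Y) (hmono : ∀ i, StrictMono (shift i)) (hlt : ∀ i v, v < shift i v)
    (hx : ∀ i v, x (shift i v) = Ω.der i (x v))
    (i : Fin m) (v : Y) {a : R}
    (ha : a ∈ Algebra.adjoin K (x '' Set.Iio v)) :
    Ω.der i a ∈ Algebra.adjoin K (x '' Set.Iio (shift i v)) := by
  refine hΩ.der_mem_adjoin i ?_ ?_ ha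
  · exact (Set.image_mono (Set.Iio_subset_Iio (hlt i v).le)).trans Algebra.subset_adjoin
  · rintro _ ⟨w, hw, rfl⟩
    exact Algebra.subset_adjoin ⟨shift i w, hmono i hw, hx i w⟩

/-- The separant of a polynomial relation of minimal degree at a leader `v` is a common denominator
for all proper derivatives of `v`. -/
theorem exists_separant [IsDomain R] [CharZero K] (hΩ : IsDifferentialAlgebra Δ Ω) (x : Y → R)
    (shift : Fin m → Y → Y) (hmono : ∀ i, StrictMono (shift i)) (hlt : ∀ i v, v < shift i v)
    (hx : ∀ i v, x (shift i v) = Ω.der i (x v))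
    (v : Y)
    (hv : ¬ Transcendental (Algebra.adjoin K (x '' Set.Iio v)) (x v)) :
    ∃ σ ∈ Algebra.adjoin K (x '' Set.Iic v), σ ≠ 0 ∧ ∀ w, Relation.TransGen
      (fun a b => ∃ i, b = shift i a) v w → σ * x w ∈ Algebra.adjoin K (x '' Set.Iio w) := by
  classical
  set B := Algebra.adjoin K (x '' Set.Iio v) with hB
  have : CharZero B := charZero_of_injective_algebraMap (algebraMap K B).injective
  have hex : ∃ n, ∃ p : B[X], p ≠ 0 ∧ aeval (x v) p = 0 ∧ p.natDegree = n := by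
    rw [transcendental_iff] at hv
    push Not at hv
    obtain ⟨p, hp, hp0⟩ := hv
    exact ⟨_, p, hp0, hp, rfl⟩
  obtain ⟨p, hp0, hp, hpn⟩ := Nat.find_spec hex
  have hdeg : p.natDegree ≠ 0 := fun h => by
    rw [eq_C_of_natDegree_eq_zero h, aeval_C] at hp
    apply hp0
    rw [eq_C_of_natDegree_eq_zero h, C_eq_zero]
    exact Subtype.ext hp
  -- In characteristic zero the derivative of `p` is nonzero of smaller degree, so minimality of the
  -- degree keeps `x v` from being a root of it.
  have hσ0 : aeval (x v) (derivative p) ≠ 0 := fun h => by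
    have h1 : derivative p ≠ 0 := fun h => hdeg (derivative_eq_zero.mp h)
    exact Nat.find_min hex (hpn ▸ natDegree_derivative_lt hdeg) ⟨_, h1, h, rfl⟩
  have hBle : B ≤ Algebra.adjoin K (x '' Set.Iic v) :=
    Algebra.adjoin_mono (Set.image_mono Set.Iio_subset_Iic_self)
  have hσ : aeval (x v) (derivative p) ∈ Algebra.adjoin K (x '' Set.Iic v) := by
    rw [aeval_eq_sum_range]
    refine sum_mem fun k _ => mul_mem (hBle (SetLike.coe_mem _)) (pow_mem ?_ _)
    exact Algebra.subset_adjoin ⟨v, le_rfl, rfl⟩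
  refine ⟨_, hσ, hσ0, fun w hw => ?_⟩
  -- The inequality `v < w` is carried along because it places the separant, and hence its
  -- derivative after a shift, among strictly lower elements.
  suffices v < w ∧ aeval (x v) (derivative p) * x w ∈ Algebra.adjoin K (x '' Set.Iio w) from this.2
  induction hw with
  | single h =>
    obtain ⟨i, rfl⟩ := h
    refine ⟨hlt i v, ?_⟩
    -- Differentiating `p(x v) = 0` shows that the separant times `x (shift i v)` is a polynomial in
    -- lower elements.
    have h1 := Derivation.aeval_sub_mem (Ω.der i) B
      (Algebra.adjoin K (x '' Set.Iio (shift i v)))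
      (fun b hb => der_mem_adjoin_Iio hΩ x shift hmono hlt hx i v hb) (x v)
      (Algebra.subset_adjoin ⟨v, hlt i v, rfl⟩) p
    rw [hp, map_zero, zero_sub, neg_mem_iff] at h1
    rwa [hx]
  | tail _ h ih =>
    obtain ⟨i, rfl⟩ := h
    rename_i w _
    obtain ⟨hvw, ih⟩ := ih
    have hle : Algebra.adjoin K (x '' Set.Iic v) ≤ Algebra.adjoin K (x '' Set.Iio w) :=
      Algebra.adjoin_mono (Set.image_mono fun u hu => lt_of_le_of_lt hu hvw)
    refine ⟨hvw.trans (hlt i w), ?_⟩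
    have h1 := der_mem_adjoin_Iio hΩ x shift hmono hlt hx i w ih
    have h2 := der_mem_adjoin_Iio hΩ x shift hmono hlt hx i w (hle hσ)
    rw [Derivation.leibniz, smul_eq_mul, smul_eq_mul, ← hx] at h1
    refine (add_mem_cancel_right (mul_mem ?_ h2)).mp h1
    exact Algebra.subset_adjoin ⟨w, hlt i w, rfl⟩

/-- A family of derivatives in which finitely many leaders generate all of them: there is a finite
initial segment and a nonzero element of the algebra it generates such that points of this algebra
where the element does not vanish extend to the algebra of all derivatives. -/
theorem exists_finite_initial_segment [IsDomain R] [CharZero K] [WellFoundedLT Y]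
    (hΩ : IsDifferentialAlgebra Δ Ω) (x : Y → R)
    (shift : Fin m → Y → Y) (hmono : ∀ i, StrictMono (shift i)) (hlt : ∀ i v, v < shift i v)
    (hx : ∀ i v, x (shift i v) = Ω.der i (x v))
    (hfin : ∀ v : Y, (Set.Iic v).Finite) (E : Set Y) (hE : E.Finite)
    (hEl : ∀ v ∈ E, ¬ Transcendental (Algebra.adjoin K (x '' Set.Iio v)) (x v))
    (hgen : ∀ w, ¬ Transcendental (Algebra.adjoin K (x '' Set.Iio w)) (x w) →
      ∃ v ∈ E, Relation.ReflTransGen (fun a b => ∃ i, b = shift i a) v w) :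
    ∃ (I₀ : Set Y) (η : Algebra.adjoin K (x '' I₀)), I₀.Finite ∧ (η : R) ≠ 0 ∧
      ∀ φ : Algebra.adjoin K (x '' I₀) →ₐ[K] K, φ η ≠ 0 →
        Nonempty (Algebra.adjoin K (Set.range x) →ₐ[K] K) := by
  classical
  choose! σ hσ hσ0 hσm using fun v (hv : v ∈ E) =>
    exists_separant hΩ x shift hmono hlt hx v (hEl v hv)
  let I₀ : Set Y := ⋃ v ∈ E, Set.Iic v
  have hI₀ : IsLowerSet I₀ := isLowerSet_iUnion₂ fun v _ => isLowerSet_Iic v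
  have hσI : ∀ v ∈ E, σ v ∈ Algebra.adjoin K (x '' I₀) := fun v hv =>
    Algebra.adjoin_mono (Set.image_mono (Set.subset_biUnion_of_mem hv)) (hσ v hv)
  refine ⟨I₀, ⟨∏ v ∈ hE.toFinset, σ v, prod_mem fun v hv => hσI v (hE.mem_toFinset.mp hv)⟩,
    hE.biUnion fun v _ => hfin v,
    Finset.prod_ne_zero_iff.mpr fun v hv => hσ0 v (hE.mem_toFinset.mp hv), fun φ hφ =>
    exists_algHom_adjoin_range x I₀ hI₀ φ _ hφ fun w hw => ?_⟩
  -- Outside `I₀` an algebraic `w` is a proper derivative of some `v` in `E`. Its separant divides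
  -- `η`, and the other separants already involve only elements below `w`.
  by_cases h : Transcendental (Algebra.adjoin K (x '' Set.Iio w)) (x w)
  · exact Or.inl h
  · right
    obtain ⟨v, hv, hvw⟩ := hgen w h
    have hlow : I₀ ⊆ Set.Iio w := fun u hu => lt_of_not_ge fun h => hw (hI₀ h hu)
    have hne : w ≠ v := by
      rintro rfl
      exact hw (Set.mem_biUnion hv (Set.mem_Iic.mpr le_rfl))
    have hvw' := (Relation.reflTransGen_iff_eq_or_transGen.mp hvw).resolve_left hne
    change (∏ v ∈ hE.toFinset, σ v) * x w ∈ _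
    rw [← Finset.prod_erase_mul _ σ (hE.mem_toFinset.mpr hv), mul_assoc]
    refine mul_mem (prod_mem fun u hu => ?_) (hσm v hv w hvw')
    exact Algebra.adjoin_mono (Set.image_mono hlow)
      (hσI u (hE.mem_toFinset.mp (Finset.mem_of_mem_erase hu)))
end Leaders

/-! ### The orderly ranking and finiteness of the set of minimal leaders. -/

section Derivatives
variable {m : ℕ}

/-- Dickson's lemma: the minimal elements of `L` form an antichain in a well-quasi-order. -/
theorem exists_finite_le_of_finsupp (L : Set (Fin m →₀ ℕ)) :
    ∃ E ⊆ L, E.Finite ∧ ∀ θ ∈ L, ∃ ε ∈ E, ε ≤ θ :=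
  ⟨{θ | Minimal (· ∈ L) θ}, fun _ h => h.prop,
    (setOfPred_minimal_antichain _).finite_of_partiallyWellOrderedOn
      (Set.isPWO_of_wellQuasiOrderedLE _), fun θ hθ => by
    obtain ⟨ε, hε, hmin⟩ := exists_minimal_le_of_wellFoundedLT (· ∈ L) θ hθ
    exact ⟨ε, hmin, hε⟩⟩

/-- The multi-indices of derivatives of `n` differential indeterminates with their orderly
ranking. -/
abbrev DerivativeIndex (m n : ℕ) := DegLex (Fin m →₀ ℕ) ×ₗ Fin n

/-- The index of the `i`-th derivative. -/
noncomputable def DerivativeIndex.shift {n : ℕ} (i : Fin m) (v : DerivativeIndex m n) :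
    DerivativeIndex m n :=
  toLex (toDegLex (Finsupp.single i 1) + (ofLex v).1, (ofLex v).2)

theorem DerivativeIndex.shift_strictMono {n : ℕ} (i : Fin m) :
    StrictMono (DerivativeIndex.shift (n := n) i) := fun v w h => by
  rw [Prod.Lex.lt_iff] at h ⊢
  obtain h | ⟨h, h'⟩ := h
  · exact Or.inl (add_lt_add_right h _)
  · exact Or.inr ⟨congrArg (_ + ·) h, h'⟩

theorem DerivativeIndex.lt_shift {n : ℕ} (i : Fin m) (v : DerivativeIndex m n) :
    v < DerivativeIndex.shift i v := by
  rw [Prod.Lex.lt_iff]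
  refine Or.inl (lt_add_of_pos_left _ ?_)
  rw [Finsupp.DegLex.lt_iff]
  left
  change (0 : Fin m →₀ ℕ).degree < (Finsupp.single i 1 : Fin m →₀ ℕ).degree
  simp

/-- The ranking compares total degree first, and there are finitely many multi-indices of bounded
degree. This is what makes the controlling subalgebra finitely generated. -/
theorem DerivativeIndex.finite_Iic {n : ℕ} (v : DerivativeIndex m n) : (Set.Iic v).Finite := by
  have h1 : {θ : Fin m →₀ ℕ | θ.degree ≤ (ofDegLex (ofLex v).1).degree}.Finite :=
    Finsupp.finite_of_degree_le _
  refine Set.Finite.subset ((h1.prod (Set.finite_univ (α := Fin n))).image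
    fun p => toLex (toDegLex p.1, p.2)) fun w hw => ?_
  refine ⟨(ofDegLex (ofLex w).1, (ofLex w).2), ⟨Finsupp.DegLex.monotone_degree ?_, trivial⟩, rfl⟩
  rcases Prod.Lex.le_iff.mp hw with h | h
  · exact h.le
  · exact h.1.le

theorem DerivativeIndex.reflTransGen {n : ℕ} (j : Fin n) (γ ε : Fin m →₀ ℕ) :
    Relation.ReflTransGen (fun a b : DerivativeIndex m n => ∃ i, b = DerivativeIndex.shift i a)
      (toLex (toDegLex ε, j)) (toLex (toDegLex (γ + ε), j)) := by
  induction γ using Finsupp.induction_linear generalizing ε with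
  | zero => rw [zero_add]
  | add f g hf hg =>
    rw [add_assoc]
    exact (hg ε).trans (hf (g + ε))
  | single i b =>
    induction b with
    | zero => rw [Finsupp.single_zero, zero_add]
    | succ b ih =>
      refine ih.tail ⟨i, ?_⟩
      rw [add_comm b, Finsupp.single_add, add_assoc]
      rfl

/-- Points of the differential algebra generated by finitely many elements of a differential domain
are controlled by a finitely generated subalgebra. -/
theorem exists_fg_subalgebra_forall_exists_der_closed {n : ℕ} {K R : Type*} [Field K] [CharZero K]
    [CommRing R] [IsDomain R] [Algebra K R] {Δ : CommutingDerivations m K}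
    {Ω : CommutingDerivations m R} (hΩ : IsDifferentialAlgebra Δ Ω) (s : Fin n → R) :
    ∃ (B : Subalgebra K R) (η : B), Algebra.FiniteType K B ∧ (η : R) ≠ 0 ∧
      ∀ φ : B →ₐ[K] K, φ η ≠ 0 → ∃ D : Subalgebra K R, (∀ j, s j ∈ D) ∧
        (∀ i, ∀ a ∈ D, Ω.der i a ∈ D) ∧ Nonempty (D →ₐ[K] K) := by
  let d : Fin m → Module.End ℤ R := fun i => (Ω.der i : R →ₗ[ℤ] R)
  have hd : ∀ i j, Commute (d i) (d j) := fun i j => LinearMap.ext fun a => Ω.comm i j a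
  let x : DerivativeIndex m n → R := fun v =>
    multiIter d hd (ofDegLex (ofLex v).1) (s (ofLex v).2)
  have hx : ∀ i v, x (DerivativeIndex.shift i v) = Ω.der i (x v) := fun i v => by
    have h : ofDegLex (ofLex (DerivativeIndex.shift i v)).1 =
        ofDegLex (ofLex v).1 + Finsupp.single i 1 :=
      add_comm (Finsupp.single i 1) (ofDegLex (ofLex v).1)
    exact (congrArg (fun θ => multiIter d hd θ (s (ofLex v).2)) h).trans
      (LinearMap.congr_fun (multiIter_single_add d hd i _) _)
  let idx : (Fin m →₀ ℕ) → Fin n → DerivativeIndex m n := fun θ j => toLex (toDegLex θ, j)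
  let IsLeader : DerivativeIndex m n → Prop := fun v =>
    ¬ Transcendental (Algebra.adjoin K (x '' Set.Iio v)) (x v)
  choose E hEL hEfin hE using fun j : Fin n =>
    exists_finite_le_of_finsupp (Set.ofPred fun θ => IsLeader (idx θ j))
  have hgen : ∀ w, IsLeader w → ∃ v ∈ ⋃ j, (fun θ => idx θ j) '' E j, Relation.ReflTransGen
      (fun a b : DerivativeIndex m n => ∃ i, b = DerivativeIndex.shift i a) v w := fun w hw => by
    obtain ⟨ε, hε, hle⟩ := hE (ofLex w).2 (ofDegLex (ofLex w).1) hw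
    refine ⟨idx ε (ofLex w).2, Set.mem_iUnion.mpr ⟨(ofLex w).2, ε, hε, rfl⟩, ?_⟩
    have := DerivativeIndex.reflTransGen (ofLex w).2 (ofDegLex (ofLex w).1 - ε) ε
    rw [tsub_add_cancel_of_le hle] at this
    exact this
  have hlead : ∀ v ∈ ⋃ j, (fun θ => idx θ j) '' E j, IsLeader v := fun v hv => by
    obtain ⟨j, θ, hθ, rfl⟩ := Set.mem_iUnion.mp hv
    exact hEL j hθ
  obtain ⟨I₀, η, hI₀, hη, H⟩ := exists_finite_initial_segment hΩ x DerivativeIndex.shift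
    DerivativeIndex.shift_strictMono DerivativeIndex.lt_shift hx DerivativeIndex.finite_Iic
    _ (Set.finite_iUnion fun j => (hEfin j).image _) hlead hgen
  refine ⟨_, η, ?_, hη, fun φ hφ => ⟨_, fun j => ?_, fun i a ha => ?_, H φ hφ⟩⟩
  · exact (Subalgebra.fg_iff_finiteType _).mp (Subalgebra.fg_def.mpr ⟨_, hI₀.image x, rfl⟩)
  · refine Algebra.subset_adjoin ⟨toLex (toDegLex 0, j), ?_⟩
    change multiIter d hd 0 (s j) = s j
    rw [multiIter_zero]
    rfl
  · refine hΩ.der_mem_adjoin i Algebra.subset_adjoin ?_ ha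
    rintro _ ⟨v, rfl⟩
    exact Algebra.subset_adjoin ⟨_, hx i v⟩
end Derivatives

/-! ### Derivations on ultrapowers, and points in ultrapowers from existential closedness. -/

section DifferentialUltrapower
open Filter

/-- The termwise extension of commuting derivations to a ring of germs. -/
noncomputable def CommutingDerivations.germ {m : ℕ} {ι K : Type*} [Field K]
    (Δ : CommutingDerivations m K) (U : Ultrafilter ι) :
    CommutingDerivations m (Germ (U : Filter ι) K) where
  der i := SelfDerivation.ofAddMonoidHom
    { toFun := Germ.map (Δ.der i)
      map_zero' := congrArg (Germ.ofFun (l := (U : Filter ι))) (funext fun _ => map_zero (Δ.der i))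
      map_add' := fun a b => Germ.inductionOn₂ a b fun a b =>
        congrArg (Germ.ofFun (l := (U : Filter ι))) (funext fun _ => map_add (Δ.der i) _ _) }
    fun a b => Germ.inductionOn₂ a b fun a b =>
      congrArg (Germ.ofFun (l := (U : Filter ι))) (funext fun j => by
        change Δ.der i (a j * b j) = Δ.der i (a j) * b j + a j * Δ.der i (b j)
        rw [Derivation.leibniz, smul_eq_mul, smul_eq_mul]
        ring)
  comm i j a := Germ.inductionOn a fun a =>
    congrArg (Germ.ofFun (l := (U : Filter ι))) (funext fun k => Δ.comm i j (a k))

theorem CommutingDerivations.isDifferentialAlgebra_germ {m : ℕ} {ι K : Type*} [Field K]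
    (Δ : CommutingDerivations m K) (U : Ultrafilter ι) : IsDifferentialAlgebra Δ (Δ.germ U) :=
  fun _ _ => rfl

variable {K L S : Type*} [Field K] [Field L] [Algebra K L] [CommRing S] [Algebra K S]

theorem IsExistentiallyClosedIn.exists_aeval_eq_zero (hL : IsExistentiallyClosedIn K L) {σ : Type*}
    (b : σ → L) (F : Finset (MvPolynomial σ K)) (hF : ∀ P ∈ F, MvPolynomial.aeval b P = 0) :
    ∃ a : σ → K, ∀ P ∈ F, MvPolynomial.aeval a P = 0 := by
  classical
  let V := F.biUnion MvPolynomial.vars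
  let g : Fin V.card → σ := fun i => V.equivFin.symm i
  have hg : Function.Injective g := Subtype.val_injective.comp V.equivFin.symm.injective
  have hren : ∀ P ∈ F, ∃ q, MvPolynomial.rename g q = P := fun P hP =>
    MvPolynomial.exists_rename_eq_of_vars_subset_range P g hg fun v hv =>
      ⟨V.equivFin ⟨v, Finset.mem_biUnion.mpr ⟨P, hP, hv⟩⟩, by simp [g]⟩
  choose! q hq using hren
  obtain ⟨a, ha, -⟩ := hL V.card (F.image q) ∅ ⟨b ∘ g, by
    refine ⟨fun Q hQ => ?_, by simp⟩
    obtain ⟨P, hP, rfl⟩ := Finset.mem_image.mp hQ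
    rw [← MvPolynomial.aeval_rename, hq P hP, hF P hP]⟩
  -- Variables that do not occur in the finite system receive the value `0`.
  refine ⟨Function.extend g a 0, fun P hP => ?_⟩
  rw [← hq P hP, MvPolynomial.aeval_rename,
    show Function.extend g a 0 ∘ g = a from funext fun i => hg.extend_apply _ _ i]
  exact ha _ (Finset.mem_image_of_mem q hP)

/-- A `K`-algebra with a point in an extension in which `K` is existentially closed has a point in
an ultrapower of `K`. -/
theorem IsExistentiallyClosedIn.exists_algHom_germ (hL : IsExistentiallyClosedIn K L)
    (f : S →ₐ[K] L) : ∃ U : Ultrafilter (Finset (MvPolynomial S K)),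
      Nonempty (S →ₐ[K] Germ (U : Filter (Finset (MvPolynomial S K))) K) := by
  classical
  have hsol : ∀ F : Finset (MvPolynomial S K), ∃ a : S → K, ∀ P ∈ F,
      MvPolynomial.aeval (id : S → S) P = 0 → MvPolynomial.aeval a P = 0 := fun F => by
    obtain ⟨a, ha⟩ := hL.exists_aeval_eq_zero f
      (F.filter fun P => MvPolynomial.aeval (id : S → S) P = 0) fun P hP => by
        have := MvPolynomial.comp_aeval_apply (id : S → S) f P
        rw [(Finset.mem_filter.mp hP).2, map_zero] at this
        exact this.symm
    exact ⟨a, fun P hP h => ha P (Finset.mem_filter.mpr ⟨hP, h⟩)⟩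
  choose a ha using hsol
  -- Indices are finite sets `F` of polynomials in variables indexed by `S`, and `a F` satisfies
  -- those members of `F` that are relations in `S`. An ultrafilter finer than `atTop` makes each
  -- relation hold almost everywhere.
  let U : Ultrafilter (Finset (MvPolynomial S K)) := Ultrafilter.of atTop
  let π : MvPolynomial S K →ₐ[K] S := MvPolynomial.aeval id
  have hπ : Function.Surjective π := fun s => ⟨MvPolynomial.X s, MvPolynomial.aeval_X _ _⟩
  let ψ : MvPolynomial S K →ₐ[K] (Finset (MvPolynomial S K) → K) :=
    MvPolynomial.aeval fun s F => a F s
  have hψ : ∀ P F, ψ P F = MvPolynomial.aeval (a F) P := fun P F =>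
    MvPolynomial.comp_aeval_apply _ (Pi.evalAlgHom K (fun _ => K) F) P
  refine ⟨U, ⟨AlgHom.liftOfSurjective π hπ ((Germ.coeAlgHom K (U : Filter _)).comp ψ)
    fun P hP => ?_⟩⟩
  change Germ.coeAlgHom K (U : Filter _) (ψ P) = 0
  rw [Germ.coeAlgHom_eq_zero_iff]
  refine (Ultrafilter.of_le atTop) ((eventually_ge_atTop {P}).mono fun F hF => ?_)
  rw [hψ]
  exact ha F P (hF (Finset.mem_singleton_self P)) hP
end DifferentialUltrapower

/-! ### Assembling the proof. -/

theorem IsDifferentialAlgebra.powerSeries {m : ℕ} {K A : Type*} [Field K] [Field A] [Algebra K A]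
    {Δ : CommutingDerivations m K} {Ω : CommutingDerivations m A}
    (h : IsDifferentialAlgebra Δ Ω) : IsDifferentialAlgebra Δ Ω.powerSeries := fun i c => by
  rw [MvPowerSeries.algebraMap_apply, MvPowerSeries.algebraMap_apply, h i c]
  exact (seriesDerivation_C Ω i _).symm

/-- A differentially finitely generated algebra over a large differential field `K` has a
`K`-point, not necessarily differential, as soon as it has a point in an extension in which `K` is
existentially closed. -/
theorem IsLargeField.nonempty_algHom {m : ℕ} {K : Type*} [Field K] [CharZero K]
    (Δ : CommutingDerivations m K) (hK : IsLargeField K)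
    {S : Type*} [CommRing S] [Algebra K S] (Ω : CommutingDerivations m S)
    (hS : IsDifferentialAlgebra Δ Ω) (hfg : IsDifferentiallyFG K Ω)
    {L : Type*} [Field L] [Algebra K L] (hL : IsExistentiallyClosedIn K L)
    (f : S →ₐ[K] L) : Nonempty (S →ₐ[K] K) := by
  obtain ⟨U, ⟨ψ⟩⟩ := hL.exists_algHom_germ f
  -- The point `ψ` need not respect derivations. Its Taylor expansion does, and it takes values in a
  -- differential domain, where separants are available.
  obtain ⟨T, hT⟩ := exists_differentialHom_powerSeries Ω (Δ.germ U) hS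
    (Δ.isDifferentialAlgebra_germ U) ψ
  obtain ⟨s, hs⟩ := hfg
  have : IsDomain (MvPowerSeries (Fin m) (Filter.Germ (U : Filter (Finset (MvPolynomial S K))) K)) :=
    NoZeroDivisors.to_isDomain _
  obtain ⟨B, η, hB, hη, H⟩ := exists_fg_subalgebra_forall_exists_der_closed
    (Δ.isDifferentialAlgebra_germ U).powerSeries fun j : Fin s.card => T (s.equivFin.symm j)
  obtain ⟨ρ, hρ⟩ := MvPowerSeries.exists_algHom_powerSeries_ne_zero
    (A := Filter.Germ (U : Filter (Finset (MvPolynomial S K))) K) (m := m) η.1 hη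
  obtain ⟨φ, hφ⟩ := hK.exists_algHom_of_algHom_powerSeries
    ((ρ.restrictScalars K).comp B.val) η hρ
  obtain ⟨D, hsD, hD, ⟨θ⟩⟩ := H φ hφ
  -- Because `T` is differential, the preimage of `D` is closed under the derivations; it contains
  -- the generators of `S`, so the point of `D` pulls back to all of `S`.
  have htop : D.comap T = ⊤ := by
    refine hs _ (fun a ha => ?_) fun i a ha => ?_
    · have := hsD (s.equivFin ⟨a, ha⟩)
      rwa [Equiv.symm_apply_apply] at this
    · have h := hT i a
      change T (Ω.der i a) ∈ D
      change T (Ω.der i a) = _ at h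
      rw [h]
      exact hD i _ ha
  exact ⟨θ.comp (T.codRestrict D fun a => by
    have : a ∈ D.comap T := htop ▸ Algebra.mem_top
    exact this)⟩

/-- The Taylor construction is used a second time, now over `K` itself, to make the `K`-point of `S`
differential. -/
theorem mainTheorem2 {m : ℕ} {K : Type*} [Field K] [CharZero K]
    (Δ : CommutingDerivations m K) (hK : IsLargeField K)
    {S : Type*} [CommRing S] [Algebra K S] (Ω : CommutingDerivations m S)
    (hS : IsDifferentialAlgebra Δ Ω) (hfg : IsDifferentiallyFG K Ω)
    {L : Type*} [Field L] [Algebra K L] (hL : IsExistentiallyClosedIn K L)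
    (f : S →ₐ[K] L) :
    ∃ φ : S →ₐ[K] MvPowerSeries (Fin m) K,
      IsDifferentialHom Ω Δ.powerSeries (φ : S →+* MvPowerSeries (Fin m) K) := by
  obtain ⟨φ⟩ := hK.nonempty_algHom Δ Ω hS hfg hL f
  exact exists_differentialHom_powerSeries Ω Δ hS (fun _ _ => rfl) φ
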